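/- All graphs are finite and simple. For a graph $G$ let $\Delta = \Delta(G)$ be its maximum degree, let $t_\Delta$ be the number of vertices of degree $\Delta$, and let $\chi'(G)$ be its chromatic index, the minimum number of colors in a proper edge coloring. $G$ is Class 2 if $\chi'(G) = \Delta(G) + 1$. The chromatic edge stability index $\mathrm{es}_{\chi'}(G)$ of a graph $G$ with at least one edge is the minimum number of edges whose removal results in a graph $H$ with $\chi'(H) = \chi'(G) - 1$. Theorem. Let $G$ be a graph of Class 2. Then $$\mathrm{es}_{\chi'}(G) \le \frac{t_\Delta - 1}{2}.$$ Furthermore, if $G$ is connected and $t_\Delta$ is odd, then equality holds if and only if, for some integers $n$ and $s$ with $0 \le s \le n-1$, $G$ is isomorphic to a graph obtained from the complete graph $K_{2n+1}$ by removing $s$ independent (that is, pairwise non-incident) edges. -/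

import Mathlib

namespace SimpleGraph

variable {V : Type*}

/-- The chromatic index `χ'(G)`: the least number of colours in a proper edge colouring of `G`,
that is, in a proper vertex colouring of its line graph. -/
noncomputable def chromaticIndex (G : SimpleGraph V) : ℕ∞ :=
  G.lineGraph.chromaticNumber

/-- `G` is Class 2 if `χ'(G) = Δ(G) + 1`. -/
def IsClassTwo [Fintype V] (G : SimpleGraph V) [DecidableRel G.Adj] : Prop :=
  G.chromaticIndex = (G.maxDegree : ℕ∞) + 1

/-- `t_i`: the number of vertices of degree `i`. -/
def numDegree [Fintype V] (G : SimpleGraph V) [DecidableRel G.Adj] (i : ℕ) : ℕ :=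
  (Finset.univ.filter fun v => G.degree v = i).card

/-- The chromatic edge stability index `es_{χ'}(G)` of a finite graph: the minimum number of edges
whose removal results in a graph `H` with `χ'(H) = χ'(G) - 1`. The minimum is attained as soon as
`G` has an edge, see `exists_card_eq_edgeStabilityIndex`. -/
noncomputable def edgeStabilityIndex [Finite V] (G : SimpleGraph V) : ℕ :=
  sInf {k : ℕ | ∃ F : Finset (Sym2 V), (F : Set (Sym2 V)) ⊆ G.edgeSet ∧ F.card = k ∧
    (G.deleteEdges F).chromaticIndex + 1 = G.chromaticIndex}

/-- `G` is (isomorphic to) a graph obtained from the complete graph `K_m` by removing `s`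
independent edges. -/
def IsCompleteMinusIndepEdges (G : SimpleGraph V) (m s : ℕ) : Prop :=
  ∃ M : (completeGraph (Fin m)).Subgraph, M.IsMatching ∧ M.edgeSet.ncard = s ∧
    Nonempty (G ≃g (completeGraph (Fin m)).deleteEdges M.edgeSet)

theorem chromaticIndex_le_deleteEdges_singleton_add_one [Finite V] (G : SimpleGraph V)
    (e : Sym2 V) : G.chromaticIndex ≤ (G.deleteEdges {e}).chromaticIndex + 1 := by
  classical
  have hc : (G.deleteEdges {e}).lineGraph.chromaticNumber ≠ ⊤ :=
    chromaticNumber_ne_top_iff_exists.2 ⟨_, colorable_chromaticNumber_of_fintype _⟩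
  obtain ⟨k, hk⟩ := ENat.ne_top_iff_exists.1 hc
  obtain ⟨C⟩ := chromaticNumber_le_iff_colorable.1 hk.symm.le
  unfold chromaticIndex
  rw [← hk]
  have : G.lineGraph.Colorable (k + 1) := by
    refine ⟨Coloring.mk (fun f => if h : (f : Sym2 V) = e then Fin.last k else
      (C ⟨f, by simpa [edgeSet_deleteEdges] using h⟩).castSucc) ?_⟩
    intro f g hfg
    rw [lineGraph_adj_iff_exists] at hfg
    obtain ⟨hne, v, hvf, hvg⟩ := hfg
    have hne' : (f : Sym2 V) ≠ g := fun h => hne (Subtype.ext h)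
    by_cases hf : (f : Sym2 V) = e <;> by_cases hg : (g : Sym2 V) = e
    · exact absurd (hf.trans hg.symm) hne'
    · simp only [hf, hg, dite_true, dite_false]
      exact (Fin.castSucc_lt_last _).ne'
    · simp only [hf, hg, dite_true, dite_false]
      exact (Fin.castSucc_lt_last _).ne
    · simp only [hf, hg, dite_false, ne_eq, Fin.castSucc_inj]
      apply C.valid
      rw [lineGraph_adj_iff_exists]
      exact ⟨fun h => hne' (by simpa using congrArg Subtype.val h), v, hvf, hvg⟩
  exact_mod_cast chromaticNumber_le_iff_colorable.2 this

theorem exists_chromaticIndex_deleteEdges_eq [Finite V] (N : ℕ) :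
    ∀ G : SimpleGraph V, G.edgeSet.ncard = N → ∀ m : ℕ, (m : ℕ∞) ≤ G.chromaticIndex →
      ∃ F : Finset (Sym2 V), (F : Set (Sym2 V)) ⊆ G.edgeSet ∧
        (G.deleteEdges F).chromaticIndex = m := by
  classical
  induction N with
  | zero =>
    intro G hG m hm
    have h0 : G.edgeSet = ∅ := (Set.ncard_eq_zero (Set.toFinite _)).1 hG
    have : IsEmpty G.edgeSet := by rw [h0]; infer_instance
    have h1 : G.chromaticIndex = 0 := by
      exact le_antisymm (Colorable.of_isEmpty (G := G.lineGraph) 0).chromaticNumber_le bot_le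
    exact ⟨∅, by simp, by simpa [h1, eq_comm] using hm⟩
  | succ N ih =>
    intro G hG m hm
    rcases hm.eq_or_lt with h | h
    · exact ⟨∅, by simp, by simpa using h.symm⟩
    · obtain ⟨e, he⟩ : G.edgeSet.Nonempty := Set.nonempty_of_ncard_ne_zero (by omega)
      have h1 : (G.deleteEdges {e}).edgeSet.ncard = N := by
        rw [edgeSet_deleteEdges, Set.ncard_sdiff_singleton_of_mem he, hG]; rfl
      have h2 : (m : ℕ∞) ≤ (G.deleteEdges {e}).chromaticIndex :=
        (ENat.add_le_add_iff_right ENat.one_ne_top).1 ((Order.add_one_le_of_lt h).trans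
          (G.chromaticIndex_le_deleteEdges_singleton_add_one e))
      obtain ⟨F, hF, hF'⟩ := ih _ h1 m h2
      refine ⟨insert e F, ?_, ?_⟩
      · intro x hx
        rcases Finset.mem_insert.1 (Finset.mem_coe.1 hx) with rfl | hx
        · exact he
        · have := hF hx
          rw [edgeSet_deleteEdges] at this
          exact this.1
      · rw [deleteEdges_deleteEdges] at hF'
        rw [← hF', Finset.coe_insert, Set.insert_eq]

/-- The minimum defining the chromatic edge stability index is attained if `G` has an edge. -/
theorem exists_card_eq_edgeStabilityIndex [Finite V] (G : SimpleGraph V)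
    (hG : G.edgeSet.Nonempty) :
    ∃ F : Finset (Sym2 V), (F : Set (Sym2 V)) ⊆ G.edgeSet ∧ F.card = G.edgeStabilityIndex ∧
      (G.deleteEdges F).chromaticIndex + 1 = G.chromaticIndex := by
  have hc : G.lineGraph.chromaticNumber ≠ ⊤ :=
    chromaticNumber_ne_top_iff_exists.2 ⟨_, colorable_chromaticNumber_of_fintype _⟩
  obtain ⟨k, hk⟩ := ENat.ne_top_iff_exists.1 hc
  have : Nonempty G.edgeSet := hG.to_subtype
  have hpos : 0 < G.lineGraph.chromaticNumber :=
    (colorable_chromaticNumber_of_fintype G.lineGraph).chromaticNumber_pos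
  have hk0 : k ≠ 0 := by
    rintro rfl
    exact hpos.ne (by simpa using hk)
  obtain ⟨j, rfl⟩ := Nat.exists_eq_succ_of_ne_zero hk0
  obtain ⟨F, hF, hF'⟩ := exists_chromaticIndex_deleteEdges_eq _ G rfl j (by
    unfold chromaticIndex; rw [← hk]; exact_mod_cast Nat.le_succ j)
  have hne : {k : ℕ | ∃ F : Finset (Sym2 V), (F : Set (Sym2 V)) ⊆ G.edgeSet ∧ F.card = k ∧
      (G.deleteEdges F).chromaticIndex + 1 = G.chromaticIndex}.Nonempty :=
    ⟨F.card, F, hF, rfl, by rw [hF']; unfold chromaticIndex; rw [← hk]; simp⟩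
  exact Nat.sInf_mem hne

end SimpleGraph

/-! Write k for Δ and t for the number of vertices of degree k, the majors. The argument rests on
Vizing's adjacency lemma: in an edge-minimal subgraph that is not edge k-colourable, every
non-isolated vertex has two neighbours of degree k. So a graph with degrees at most k that is not
k-colourable has t ≥ 3 and an edge between two majors. Deleting such an edge lowers t by 2, so
repeating this until the graph is k-colourable costs at most (t - 1)/2 edges.

If equality holds (the graph is tight), every such deletion leaves a tight graph, and an odd t
descends to t = 3. The majors of a tight graph with odd t are pairwise adjacent, so the deleted edge
lies on a triangle and connectedness survives. At t = 3 a theorem of Chetwynd and Hilton gives k + 1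
vertices and k even, and the adjacency lemma gives minimum degree at least k - 1. These properties
lift back to G, whose complement is therefore a matching. The Chetwynd–Hilton theorem is proved by
contradiction: otherwise a matching missing a single vertex can be removed so that the adjacency
lemma, applied to the rest with k - 1 colours, becomes contradictory.

Conversely, K_{2n+1} minus s independent edges has n(2n + 1) - s edges, while 2n colour classes of
at most n edges cover at most 2n². At least n - s = (t - 1)/2 edges have to go. -/

namespace SimpleGraph

variable {V : Type*}

/-! ### Edge colourings and Kempe exchanges -/

/-- `φ` restricts to a proper edge colouring of `G`. -/
def IsProperEdgeColoring {α : Type*} (G : SimpleGraph V) (φ : Sym2 V → α) : Prop :=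
  ∀ u v w, G.Adj u v → G.Adj u w → φ s(u, v) = φ s(u, w) → v = w

/-- No edge of `G` at `v` has colour `c`. -/
def IsMissingAt {α : Type*} (G : SimpleGraph V) (φ : Sym2 V → α) (v : V) (c : α) : Prop :=
  ∀ w, G.Adj v w → φ s(v, w) ≠ c

/-- A graph of maximum degree at most two has at most two vertices of degree at most one in each
component. -/
theorem not_reachable_of_degree_le_one [Fintype V] (K : SimpleGraph V) [DecidableRel K.Adj]
    (h2 : ∀ v, K.degree v ≤ 2) {x u z : V} (hxu : x ≠ u) (hxz : x ≠ z) (huz : u ≠ z)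
    (hx : K.degree x ≤ 1) (hu : K.degree u ≤ 1) (hz : K.degree z ≤ 1)
    (hru : K.Reachable x u) : ¬ K.Reachable x z := by
  classical
  intro hrz
  let S : Set V := (K.connectedComponentMk x).supp
  have hconn : (K.induce S).Connected := (K.connectedComponentMk x).connected_toSimpleGraph
  have hle : ∀ v : S, (K.induce S).degree v ≤ K.degree v := by
    intro v
    rw [← card_neighborFinset_eq_degree, ← card_neighborFinset_eq_degree]
    refine Finset.card_le_card_of_injOn (fun w => (w : V)) ?_ (fun _ _ _ _ h => Subtype.ext h)
    intro w hw
    simpa using hw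
  have h1 := hconn.card_vert_le_card_edgeSet_add_one
  have h3 := (K.induce S).sum_degrees_eq_twice_card_edges
  have hxS : x ∈ S := by simp [S]
  have huS : u ∈ S := by simpa [S] using hru.symm
  have hzS : z ∈ S := by simpa [S] using hrz.symm
  let A : Finset S := {⟨x, hxS⟩, ⟨u, huS⟩, ⟨z, hzS⟩}
  have hA : A.card = 3 := by
    rw [Finset.card_eq_three]
    exact ⟨_, _, _, by simpa using hxu, by simpa using hxz, by simpa using huz, rfl⟩
  -- A component S with three such vertices has degree sum at most 2|S| - 3, hence fewer than the
  -- |S| - 1 edges that connectedness demands.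
  have h4 : ∑ v, (K.induce S).degree v + 3 ≤ ∑ _v : S, 2 := by
    have h5 : ∑ v : S, (if v ∈ A then 1 else 0) = 3 := by
      rw [← hA, Finset.card_eq_sum_ones, Finset.sum_ite_mem, Finset.univ_inter]
    rw [← h5, ← Finset.sum_add_distrib]
    refine Finset.sum_le_sum fun v _ => ?_
    split_ifs with hv
    · have : K.degree v ≤ 1 := by
        simp only [A, Finset.mem_insert, Finset.mem_singleton] at hv
        rcases hv with rfl | rfl | rfl <;> assumption
      have := hle v
      omega
    · exact (hle v).trans (h2 v)
  simp only [Finset.sum_const, smul_eq_mul, Finset.card_univ] at h4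
  rw [Nat.card_eq_fintype_card, Nat.card_eq_fintype_card, ← edgeFinset_card] at h1
  omega

/-- Kempe's exchange: if `x` misses `a`, and `u`, `z` miss `c`, then the `(a, c)`-chain of `u` or of
`z` avoids `x`, and colours can be exchanged along it. -/
theorem exists_kempe_swap [Fintype V] {α : Type*} {H : SimpleGraph V} {φ : Sym2 V → α}
    (hφ : H.IsProperEdgeColoring φ) (a c : α) :
    ∃ K : V → V → Prop, Equivalence K ∧
      (∀ x u z, x ≠ u → x ≠ z → u ≠ z → H.IsMissingAt φ x a →
        H.IsMissingAt φ u c → H.IsMissingAt φ z c → K x u → ¬ K x z) ∧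
      ∀ u, ∃ ψ : Sym2 V → α, H.IsProperEdgeColoring ψ ∧
        (H.IsMissingAt φ u c → H.IsMissingAt ψ u a) ∧
        (∀ v, ¬ K v u → ∀ w, H.Adj v w → ψ s(v, w) = φ s(v, w)) ∧
        (∀ v d, d ≠ a → d ≠ c → H.IsMissingAt φ v d → H.IsMissingAt ψ v d) := by
  classical
  let K : SimpleGraph V :=
    { Adj := fun u v => H.Adj u v ∧ (φ s(u, v) = a ∨ φ s(u, v) = c)
      symm := ⟨fun u v h => by rw [Sym2.eq_swap]; exact ⟨h.1.symm, h.2⟩⟩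
      loopless := ⟨fun u h => H.loopless.irrefl u h.1⟩ }
  have hdeg : ∀ v (s : Finset α), (∀ w, K.Adj v w → φ s(v, w) ∈ s) → K.degree v ≤ s.card := by
    intro v s hs
    rw [← card_neighborFinset_eq_degree]
    refine Finset.card_le_card_of_injOn (fun w => φ s(v, w)) (fun w hw => hs w (by simpa using hw))
      fun w hw w' hw' h => hφ v w w' ?_ ?_ h
    · exact ((K.mem_neighborFinset v w).1 hw).1
    · exact ((K.mem_neighborFinset v w').1 hw').1
  refine ⟨K.Reachable, K.reachable_is_equivalence, ?_, ?_⟩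
  · intro x u z hxu hxz huz hx hu hz hru
    refine not_reachable_of_degree_le_one K (fun v => ?_) hxu hxz huz ?_ ?_ ?_ hru
    · exact (hdeg v {a, c} (fun w hw => by simpa using hw.2)).trans Finset.card_le_two
    · exact hdeg x {c} fun w hw => by simpa using hw.2.resolve_left (hx w hw.1)
    · exact hdeg u {a} fun w hw => by simpa using hw.2.resolve_right (hu w hw.1)
    · exact hdeg z {a} fun w hw => by simpa using hw.2.resolve_right (hz w hw.1)
  · intro u
    -- Exchanging on all edges that touch the chain is harmless: an edge coloured `a` or `c` has
    -- both ends in one chain, and the swap fixes every other colour.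
    let ψ : Sym2 V → α := fun e => if ∃ v ∈ e, K.Reachable v u then Equiv.swap a c (φ e) else φ e
    have hψ : ∀ v w, H.Adj v w →
        ψ s(v, w) = if K.Reachable v u then Equiv.swap a c (φ s(v, w)) else φ s(v, w) := by
      intro v w hvw
      by_cases hK : K.Adj v w
      · have : (∃ v' ∈ s(v, w), K.Reachable v' u) ↔ K.Reachable v u := by
          constructor
          · rintro ⟨v', hv', h⟩
            rcases Sym2.mem_iff.1 hv' with rfl | rfl
            · exact h
            · exact hK.reachable.trans h
          · exact fun h => ⟨v, by simp, h⟩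
        simp only [ψ, this]
      · have hn : φ s(v, w) ≠ a ∧ φ s(v, w) ≠ c := by
          constructor <;> intro h <;> exact hK ⟨hvw, by simp [h]⟩
        simp only [ψ, Equiv.swap_apply_of_ne_of_ne hn.1 hn.2, ite_self]
    refine ⟨ψ, ?_, ?_, ?_, ?_⟩
    · intro v w w' hw hw' h
      rw [hψ v w hw, hψ v w' hw'] at h
      split_ifs at h
      · exact hφ v w w' hw hw' ((Equiv.swap a c).injective h)
      · exact hφ v w w' hw hw' h
    · intro hu w hw h
      rw [hψ u w hw, if_pos (Reachable.refl u)] at h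
      exact hu w hw ((Equiv.swap a c).injective (h.trans (Equiv.swap_apply_right a c).symm))
    · intro v hv w hw
      rw [hψ v w hw, if_neg hv]
    · intro v d hda hdc hv w hw h
      rw [hψ v w hw] at h
      split_ifs at h
      · exact hv w hw ((Equiv.swap a c).injective
          (h.trans (Equiv.swap_apply_of_ne_of_ne hda hdc).symm))
      · exact hv w hw h

/-! ### Vizing multifans -/

/-- A Vizing multifan at `x` starting from the uncoloured pair `x y`, listed from its last vertex to
its first. -/
inductive IsMultifan {α : Type*} (H : SimpleGraph V) (φ : Sym2 V → α) (x y : V) : List V → Prop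
  | base : IsMultifan H φ x y [y]
  | cons {l : List V} {z : V} : IsMultifan H φ x y l → z ∉ l → H.Adj x z →
      (∃ w ∈ l, H.IsMissingAt φ w (φ s(x, z))) → IsMultifan H φ x y (z :: l)

namespace IsMultifan

variable {α : Type*} {H : SimpleGraph V} {φ : Sym2 V → α} {x y : V} {l : List V}

theorem nodup (h : IsMultifan H φ x y l) : l.Nodup := by
  induction h with
  | base => simp
  | cons _ hz _ _ ih => exact List.nodup_cons.2 ⟨hz, ih⟩

theorem mem_base (h : IsMultifan H φ x y l) : y ∈ l := by
  induction h with
  | base => simp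
  | cons _ _ _ _ ih => exact List.mem_cons_of_mem _ ih

theorem adj_of_mem (h : IsMultifan H φ x y l) {z : V} (hz : z ∈ l) (hzy : z ≠ y) : H.Adj x z := by
  induction h with
  | base => exact absurd (by simpa using hz) hzy
  | cons _ _ hadj _ ih =>
    rcases List.mem_cons.1 hz with rfl | hz
    · exact hadj
    · exact ih hz

theorem notMem_center (h : IsMultifan H φ x y l) (hxy : x ≠ y) : x ∉ l := fun hx =>
  H.loopless.irrefl x (h.adj_of_mem hx hxy)

theorem of_append {l₁ : List V} {u : V} {l₂ : List V}
    (h : IsMultifan H φ x y (l₁ ++ u :: l₂)) : IsMultifan H φ x y (u :: l₂) := by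
  induction l₁ with
  | nil => exact h
  | cons z l ih =>
    rw [List.cons_append] at h
    generalize hl : l ++ u :: l₂ = l' at h
    cases h with
    | base => simp at hl
    | cons h _ _ _ => exact ih (hl ▸ h)

/-- The vertex missing the colour comes before `z` in the fan, so it is never the head of the list.
This matters for a fan truncated at a chosen vertex, which is then ruled out as the witness. -/
theorem exists_missing (h : IsMultifan H φ x y l) (hxy : ¬ H.Adj x y) {z : V} (hz : z ∈ l)
    (hxz : H.Adj x z) : ∃ w ∈ l.tail, H.IsMissingAt φ w (φ s(x, z)) := by
  induction h with
  | base =>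
    obtain rfl : z = y := by simpa using hz
    exact absurd hxz hxy
  | cons _ _ _ hw ih =>
    rcases List.mem_cons.1 hz with rfl | hz
    · exact hw
    · obtain ⟨w, hw, h⟩ := ih hz
      exact ⟨w, List.mem_of_mem_tail hw, h⟩

/-- A fan sees a colouring only through the colours of its own edges and through which fan vertices
miss those colours; this lets a fan survive a recolouring. -/
theorem congr {ψ : Sym2 V → α} (h : IsMultifan H φ x y l)
    (hx : ∀ z ∈ l, H.Adj x z → ψ s(x, z) = φ s(x, z))
    (hm : ∀ z ∈ l, H.Adj x z → ∀ w ∈ l, H.IsMissingAt φ w (φ s(x, z)) →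
      H.IsMissingAt ψ w (φ s(x, z))) : IsMultifan H ψ x y l := by
  induction h with
  | base => exact .base
  | @cons l z _ hz hadj hw ih =>
    refine .cons (ih (fun v hv => hx v (by simp [hv]))
      (fun v hv hxv w hw => hm v (by simp [hv]) hxv w (by simp [hw]))) hz hadj ?_
    obtain ⟨w, hwl, hw⟩ := hw
    rw [hx z (by simp) hadj]
    exact ⟨w, hwl, hm z (by simp) hadj w (by simp [hwl]) hw⟩

/-- If no proper colouring leaves a common missing colour at `x` and `y`, then no vertex of a
multifan has a common missing colour with the centre. -/
theorem not_missing_center (hxy : x ≠ y)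
    (hno : ∀ φ : Sym2 V → α, H.IsProperEdgeColoring φ → ∀ c, H.IsMissingAt φ x c →
      ¬ H.IsMissingAt φ y c) (hφ : H.IsProperEdgeColoring φ) (h : IsMultifan H φ x y l) {w : V}
    (hw : w ∈ l) {c : α} (hxc : H.IsMissingAt φ x c) : ¬ H.IsMissingAt φ w c := by
  classical
  induction l generalizing φ w c with
  | nil => simp at hw
  | cons z l ih =>
    intro hwc
    cases h with
    | base =>
      obtain rfl : w = y := by simpa using hw
      exact hno φ hφ c hxc hwc
    | cons hl hz hadj hm =>
      rcases List.mem_cons.1 hw with rfl | hw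
      swap
      · exact ih hφ hl hw hxc hwc
      have hxl := hl.notMem_center hxy
      -- Shift the fan: giving `xw` the colour `c` frees its old colour at `x`. An earlier fan
      -- vertex misses that old colour too, and the shorter fan is covered by induction.
      let ψ := Function.update φ s(x, w) c
      have hψx : ∀ v, v ≠ w → ψ s(x, v) = φ s(x, v) := by
        intro v hv
        refine Function.update_of_ne ?_ _ _
        intro h
        rcases Sym2.eq_iff.1 h with h | h
        · exact hv h.2
        · exact hadj.ne h.1
      have hψ : ∀ u v, u ≠ x → u ≠ w → ψ s(u, v) = φ s(u, v) := by
        intro u v hu hu'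
        refine Function.update_of_ne ?_ _ _
        intro h
        rcases Sym2.eq_iff.1 h with h | h
        · exact hu h.1
        · exact hu' h.1
      have hψw : ψ s(x, w) = c := Function.update_self ..
      have hψw' : ψ s(w, x) = c := by rw [Sym2.eq_swap]; exact hψw
      have hψv : ∀ v, v ≠ x → ψ s(w, v) = φ s(w, v) := by
        intro v hv
        refine Function.update_of_ne ?_ _ _
        intro h
        rcases Sym2.eq_iff.1 h with h | h
        · exact hadj.ne h.1.symm
        · exact hv h.2
      have hne : φ s(x, w) ≠ c := hxc w hadj
      have hψp : H.IsProperEdgeColoring ψ := by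
        intro u v v' hv hv' heq
        by_cases hux : u = x
        · subst hux
          by_cases h1 : v = w <;> by_cases h2 : v' = w
          · exact h1.trans h2.symm
          · rw [h1, hψw, hψx v' h2] at heq
            exact absurd heq.symm (hxc v' hv')
          · rw [h2, hψw, hψx v h1] at heq
            exact absurd heq (hxc v hv)
          · rw [hψx v h1, hψx v' h2] at heq
            exact hφ _ _ _ hv hv' heq
        by_cases huw : u = w
        · subst huw
          by_cases h1 : v = x <;> by_cases h2 : v' = x
          · exact h1.trans h2.symm
          · rw [h1, hψw', hψv v' h2] at heq
            exact absurd heq.symm (hwc v' hv')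
          · rw [h2, hψw', hψv v h1] at heq
            exact absurd heq (hwc v hv)
          · rw [hψv v h1, hψv v' h2] at heq
            exact hφ _ _ _ hv hv' heq
        · rw [hψ u v hux huw, hψ u v' hux huw] at heq
          exact hφ _ _ _ hv hv' heq
      have hmiss : ∀ u ∈ l, ∀ d, H.IsMissingAt φ u d → H.IsMissingAt ψ u d := by
        intro u hu d hd v hv
        rw [hψ u v (fun h => hxl (h ▸ hu)) (fun h => hz (h ▸ hu))]
        exact hd v hv
      obtain ⟨u, hu, hum⟩ := hm
      refine ih hψp (hl.congr (fun v hv _ => hψx v fun h => hz (h ▸ hv))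
        fun v hv _ u hu => hmiss u hu _) hu (c := φ s(x, w)) ?_ (hmiss u hu _ hum)
      intro v hv heq
      by_cases hvw : v = w
      · rw [hvw, hψw] at heq
        exact hne heq.symm
      · rw [hψx v hvw] at heq
        exact hvw (hφ _ _ _ hv hadj heq)

/-- Distinct vertices of a multifan have no common missing colour. -/
theorem not_missing_common [Fintype V] (hxy : x ≠ y) (hadj : ¬ H.Adj x y)
    (hno : ∀ φ : Sym2 V → α, H.IsProperEdgeColoring φ → ∀ c, H.IsMissingAt φ x c →
      ¬ H.IsMissingAt φ y c) (hφ : H.IsProperEdgeColoring φ) (h : IsMultifan H φ x y l) {a : α}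
    (ha : H.IsMissingAt φ x a) {u v : V} (hu : u ∈ l) (hv : v ∈ l) (huv : u ≠ v) {c : α}
    (huc : H.IsMissingAt φ u c) : ¬ H.IsMissingAt φ v c := by
  induction l generalizing u v c with
  | nil => simp at hu
  | cons z l ih =>
    have hcons := h
    cases h with
    | base =>
      simp only [List.mem_singleton] at hu hv
      exact absurd (hu.trans hv.symm) huv
    | cons hl hz hxz hm =>
      have key : ∀ u ∈ l, ∀ c, H.IsMissingAt φ u c → ¬ H.IsMissingAt φ z c := by
        intro u hu c huc hzc
        have hxu : x ≠ u := fun h => hl.notMem_center hxy (h ▸ hu)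
        have huz : u ≠ z := fun h => hz (h ▸ hu)
        obtain ⟨K, hKe, hK, hswap⟩ := exists_kempe_swap hφ a c
        -- The vertices `x`, `u`, `z` cannot all lie on one `(a, c)`-chain. Exchanging on a chain of
        -- `z` or `u` that avoids `x` makes that vertex miss `a`, as `x` does, which
        -- `not_missing_center` forbids once a fan reaching that vertex is known to survive.
        by_cases hxKu : K x u
        · have hxKz := hK x u z hxu hxz.ne huz ha huc hzc hxKu
          have huKz : ¬ K u z := fun h => hxKz (hKe.trans hxKu h)
          obtain ⟨ψ, hψ, hψz, hψK, hψm⟩ := hswap z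
          have hxa : H.IsMissingAt ψ x a := fun w hw => by rw [hψK x hxKz w hw]; exact ha w hw
          have hmiss : ∀ v, H.Adj x v → ∀ w ∈ l, H.IsMissingAt φ w (φ s(x, v)) →
              H.IsMissingAt ψ w (φ s(x, v)) := by
            intro v hxv w hw hwm
            -- No fan edge has colour `a`, which `x` misses. For colour `c` the only earlier vertex
            -- missing it is `u`, by induction, and the exchange does not touch `u`.
            by_cases hc : φ s(x, v) = c
            · have hwu : w = u := by
                by_contra hne
                exact ih hl hw hu hne hwm (hc ▸ huc)
              subst hwu
              intro v' hv'
              rw [hψK w huKz v' hv']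
              exact hwm v' hv'
            · exact hψm w _ (ha v hxv) hc hwm
          have hfan : IsMultifan H ψ x y (z :: l) := by
            refine .cons (hl.congr (fun v _ hv => hψK x hxKz v hv)
              fun v _ => hmiss v) hz hxz ?_
            obtain ⟨w, hw, hwm⟩ := hm
            rw [hψK x hxKz z hxz]
            exact ⟨w, hw, hmiss z hxz w hw hwm⟩
          exact hfan.not_missing_center hxy hno hψ List.mem_cons_self hxa (hψz hzc)
        · obtain ⟨ψ, hψ, hψu, hψK, hψm⟩ := hswap u
          have hxa : H.IsMissingAt ψ x a := fun w hw => by rw [hψK x hxKu w hw]; exact ha w hw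
          -- Truncate the fan at `u`. None of its edges has colour `c`, since a vertex before `u`
          -- would miss `c`; so the exchange affects no colour the fan relies on.
          obtain ⟨l₁, l₂, rfl⟩ := List.append_of_mem hu
          have hfan := hl.of_append
          have hnd := List.nodup_cons.1 hfan.nodup
          have hfan' : IsMultifan H ψ x y (u :: l₂) := by
            refine hfan.congr (fun v _ hv => hψK x hxKu v hv) fun v hv hxv w hw hwm =>
              hψm w _ (ha v hxv) ?_ hwm
            intro hc
            obtain ⟨w', hw', hwm'⟩ := hfan.exists_missing hadj hv hxv
            rw [List.tail_cons] at hw'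
            exact ih hl hu (by simp [hw']) (fun h => hnd.1 (h ▸ hw')) huc (hc ▸ hwm')
          exact hfan'.not_missing_center hxy hno hψ List.mem_cons_self hxa (hψu huc)
      intro hvc
      rcases List.mem_cons.1 hu with rfl | hu' <;> rcases List.mem_cons.1 hv with rfl | hv'
      · exact huv rfl
      · exact key v hv' c hvc huc
      · exact key u hu' c huc hvc
      · exact ih hl hu' hv' huv huc hvc

end IsMultifan
-- Vizing's adjacency lemma
open scoped Classical in
theorem card_missing_add_degree [Fintype V] {k : ℕ} {H : SimpleGraph V} {φ : Sym2 V → Fin k}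
    (hφ : H.IsProperEdgeColoring φ) (v : V) :
    (Finset.univ.filter fun c => H.IsMissingAt φ v c).card + H.degree v = k := by
  have h : (Finset.univ.filter fun c => ¬ H.IsMissingAt φ v c) =
      (H.neighborFinset v).image fun w => φ s(v, w) := by
    ext c
    simp [IsMissingAt]
  have h2 : (Finset.univ.filter fun c => ¬ H.IsMissingAt φ v c).card = H.degree v := by
    rw [h, Finset.card_image_of_injOn, card_neighborFinset_eq_degree]
    intro w hw w' hw' h
    exact hφ v w w' (by simpa using hw) (by simpa using hw') h
  rw [← h2, Finset.card_filter_add_card_filter_not, Finset.card_univ, Fintype.card_fin]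

/-- Vizing's adjacency lemma, in terms of the graph `H` without the uncoloured edge `xy`. -/
theorem le_degree_add_card_of_forall_not_missing [Fintype V] {k : ℕ} (H : SimpleGraph V)
    [DecidableRel H.Adj] {x y : V} (hxy : x ≠ y) (hadj : ¬ H.Adj x y)
    (hcol : ∃ φ : Sym2 V → Fin k, H.IsProperEdgeColoring φ)
    (hno : ∀ φ : Sym2 V → Fin k, H.IsProperEdgeColoring φ → ∀ c, H.IsMissingAt φ x c →
      ¬ H.IsMissingAt φ y c) (hx : H.degree x < k) :
    k ≤ H.degree y + ((H.neighborFinset x).filter fun z => k ≤ H.degree z).card := by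
  classical
  obtain ⟨φ, hφ⟩ := hcol
  obtain ⟨a, ha⟩ : ∃ a, H.IsMissingAt φ x a := by
    have h1 := card_missing_add_degree hφ x
    have h2 : (Finset.univ.filter fun c => H.IsMissingAt φ x c).Nonempty := by
      rw [← Finset.card_pos]
      convert Nat.sub_pos_of_lt hx using 1
      convert (Nat.sub_eq_of_eq_add h1.symm).symm
    obtain ⟨a, ha⟩ := h2
    exact ⟨a, by simpa using ha⟩
  obtain ⟨l, hl, hmax⟩ : ∃ l, IsMultifan H φ x y l ∧
      ∀ l', IsMultifan H φ x y l' → l'.length ≤ l.length := by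
    have hbd : ∀ l, IsMultifan H φ x y l → l.length ≤ Fintype.card V := fun l hl =>
      hl.nodup.length_le_card
    have hex : ∃ n, ∃ l, IsMultifan H φ x y l ∧ Fintype.card V - l.length = n :=
      ⟨_, [y], .base, rfl⟩
    obtain ⟨l, hl, hn⟩ := Nat.find_spec hex
    refine ⟨l, hl, fun l' hl' => ?_⟩
    have := Nat.find_min' hex ⟨l', hl', rfl⟩
    have := hbd l hl
    have := hbd l' hl'
    omega
  let m : V → Finset (Fin k) := fun v => Finset.univ.filter fun c => H.IsMissingAt φ v c
  let L := l.toFinset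
  have hyL : y ∈ L := by simpa [L] using hl.mem_base
  have hm : ∀ v, (m v).card + H.degree v = k := fun v => by
    convert card_missing_add_degree hφ v
  have h1 : (L.biUnion m).card = ∑ v ∈ L, (m v).card := by
    refine Finset.card_biUnion fun u hu v hv huv => ?_
    rw [Function.onFun, Finset.disjoint_left]
    intro c hc hc'
    exact hl.not_missing_common hxy hadj hno hφ ha (by simpa [L] using hu) (by simpa [L] using hv)
      huv (by simpa [m] using hc) (by simpa [m] using hc')
  -- A colour missing at a fan vertex is present at `x`, and by maximality on an edge to a fan
  -- vertex. As the missing sets are disjoint, their sizes sum to at most |L| - 1.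
  have h2 : L.biUnion m ⊆ (L.erase y).image fun z => φ s(x, z) := by
    intro c hc
    obtain ⟨w, hw, hwc⟩ := Finset.mem_biUnion.1 hc
    have hwl : w ∈ l := by simpa [L] using hw
    have hwm : H.IsMissingAt φ w c := by simpa [m] using hwc
    have hxc : ¬ H.IsMissingAt φ x c := fun h => hl.not_missing_center hxy hno hφ hwl h hwm
    simp only [IsMissingAt, not_forall, not_not] at hxc
    obtain ⟨z, hxz, rfl⟩ := hxc
    refine Finset.mem_image_of_mem _ (Finset.mem_erase.2 ⟨fun h => hadj (h ▸ hxz), ?_⟩)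
    by_contra hz
    have := hmax _ (hl.cons (by simpa [L] using hz) hxz ⟨w, hwl, hwm⟩)
    simp at this
  have h3 := (Finset.card_le_card h2).trans Finset.card_image_le
  rw [h1, ← Finset.add_sum_erase _ _ hyL] at h3
  -- Each fan vertex of degree below `k` misses a colour. To fit within |L| - 1, the colours missing
  -- at `y` must be offset by as many fan vertices of degree at least `k`.
  have h4 : (L.erase y).card ≤ ((L.erase y).filter fun z => k ≤ H.degree z).card +
      ∑ v ∈ L.erase y, (m v).card := by
    rw [Finset.card_eq_sum_ones, Finset.card_filter, ← Finset.sum_add_distrib]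
    refine Finset.sum_le_sum fun v _ => ?_
    have := hm v
    split_ifs <;> omega
  have h5 : ((L.erase y).filter fun z => k ≤ H.degree z).card ≤
      ((H.neighborFinset x).filter fun z => k ≤ H.degree z).card := by
    refine Finset.card_le_card (Finset.filter_subset_filter _ fun z hz => ?_)
    rw [mem_neighborFinset]
    exact hl.adj_of_mem (by simpa [L] using Finset.mem_of_mem_erase hz) (Finset.ne_of_mem_erase hz)
  have := hm y
  omega

/-- `G` has a proper edge colouring with `k` colours. -/
def EdgeColorable (G : SimpleGraph V) (k : ℕ) : Prop :=
  ∃ φ : Sym2 V → Fin k, G.IsProperEdgeColoring φ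

theorem edgeColorable_bot {k : ℕ} (hk : k ≠ 0) : (⊥ : SimpleGraph V).EdgeColorable k :=
  ⟨fun _ => ⟨0, Nat.pos_of_ne_zero hk⟩, fun _ _ _ h => absurd h (by simp)⟩

theorem edgeColorable_iff_chromaticIndex_le {G : SimpleGraph V} {k : ℕ} (hk : k ≠ 0) :
    G.EdgeColorable k ↔ G.chromaticIndex ≤ k := by
  classical
  rw [chromaticIndex, chromaticNumber_le_iff_colorable]
  constructor
  · rintro ⟨φ, hφ⟩
    refine ⟨Coloring.mk (fun e => φ e) ?_⟩
    rintro ⟨e, he⟩ ⟨f, hf⟩ hef heq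
    rw [lineGraph_adj_iff_exists] at hef
    obtain ⟨hne, v, hve, hvf⟩ := hef
    obtain ⟨u, rfl⟩ := hve
    obtain ⟨w, rfl⟩ := hvf
    have := hφ v u w he hf heq
    subst this
    exact hne rfl
  · rintro ⟨C⟩
    -- Non-edges receive the dummy colour 0, which is why `k ≠ 0` is required.
    refine ⟨fun e => if he : e ∈ G.edgeSet then C ⟨e, he⟩ else ⟨0, Nat.pos_of_ne_zero hk⟩, ?_⟩
    intro u v w hv hw heq
    beta_reduce at heq
    rw [dif_pos (show s(u, v) ∈ G.edgeSet from hv), dif_pos (show s(u, w) ∈ G.edgeSet from hw)]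
      at heq
    by_contra hne
    refine C.valid ?_ heq
    rw [lineGraph_adj_iff_exists]
    refine ⟨fun h => hne ?_, u, by simp, by simp⟩
    exact Sym2.congr_right.1 (congrArg Subtype.val h)

/-- Vizing's adjacency lemma: if `G` has no proper edge colouring with `k` colours but `G - xy`
has one, then `x` has at least `k + 1 - d(y)` neighbours of degree `≥ k` other than `y`. -/
theorem le_degree_add_card_major [Fintype V] {k : ℕ} (G : SimpleGraph V) [DecidableRel G.Adj]
    [DecidableEq V] {x y : V} (hxy : G.Adj x y) (hG : ¬ G.EdgeColorable k)
    (hcol : (G.deleteEdges {s(x, y)}).EdgeColorable k) (hx : G.degree x ≤ k) :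
    k + 1 ≤ G.degree y + (((G.neighborFinset x).erase y).filter fun z => k ≤ G.degree z).card := by
  classical
  let H := G.deleteEdges {s(x, y)}
  have hH : ∀ u v, H.Adj u v ↔ G.Adj u v ∧ s(u, v) ≠ s(x, y) := by
    intro u v
    simp [H, deleteEdges_adj]
  have hnbx : H.neighborFinset x = (G.neighborFinset x).erase y := by
    ext z
    simp only [mem_neighborFinset, hH, Finset.mem_erase, ne_eq, Sym2.congr_right]
    tauto
  have hnby : H.neighborFinset y = (G.neighborFinset y).erase x := by
    ext z
    simp only [mem_neighborFinset, hH, Finset.mem_erase, ne_eq, Sym2.eq_swap (a := x),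
      Sym2.congr_right]
    tauto
  have hnb : ∀ z, H.degree z ≤ G.degree z := fun z => degree_le_of_le (deleteEdges_le _)
  have hdx : H.degree x + 1 = G.degree x := by
    rw [← card_neighborFinset_eq_degree, hnbx, Finset.card_erase_add_one (by simpa using hxy),
      card_neighborFinset_eq_degree]
  have hdy : H.degree y + 1 = G.degree y := by
    rw [← card_neighborFinset_eq_degree, hnby, Finset.card_erase_add_one (by simpa using hxy.symm),
      card_neighborFinset_eq_degree]
  have key := le_degree_add_card_of_forall_not_missing H hxy.ne (by simp [hH]) hcol ?_
    (by omega : H.degree x < k)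
  · have : ((H.neighborFinset x).filter fun z => k ≤ H.degree z).card ≤
        (((G.neighborFinset x).erase y).filter fun z => k ≤ G.degree z).card := by
      rw [hnbx]
      refine Finset.card_le_card fun z hz => ?_
      rw [Finset.mem_filter] at hz ⊢
      exact ⟨hz.1, hz.2.trans (hnb z)⟩
    omega
  · intro φ hφ c hxc hyc
    -- A colour missing at both ends of `xy` would extend the colouring to all of `G`.
    refine hG ⟨Function.update φ s(x, y) c, ?_⟩
    have hne : ∀ u v, s(u, v) ≠ s(x, y) → Function.update φ s(x, y) c s(u, v) = φ s(u, v) :=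
      fun u v h => Function.update_of_ne h _ _
    have hmiss : ∀ u v w, s(u, v) = s(x, y) → G.Adj u w → s(u, w) ≠ s(x, y) → φ s(u, w) ≠ c := by
      intro u v w huv huw hne
      rcases Sym2.eq_iff.1 huv with h | h
      · rw [h.1] at huw hne ⊢
        exact hxc w ((hH _ _).2 ⟨huw, hne⟩)
      · rw [h.1] at huw hne ⊢
        exact hyc w ((hH _ _).2 ⟨huw, hne⟩)
    intro u v w hv hw heq
    by_cases h1 : s(u, v) = s(x, y) <;> by_cases h2 : s(u, w) = s(x, y)
    · exact Sym2.congr_right.1 (h1.trans h2.symm)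
    · rw [hne u w h2, h1, Function.update_self] at heq
      exact absurd heq.symm (hmiss u v w h1 hw h2)
    · rw [hne u v h1, h2, Function.update_self] at heq
      exact absurd heq (hmiss u w v h2 hv h1)
    · rw [hne u v h1, hne u w h2] at heq
      exact hφ u v w ((hH _ _).2 ⟨hv, h1⟩) ((hH _ _).2 ⟨hw, h2⟩) heq

/-! ### Instance-free degrees, majors and critical subgraphs -/

/-- The degree of a vertex, as the cardinality of a set. -/
noncomputable def ndeg (G : SimpleGraph V) (v : V) : ℕ := (G.neighborSet v).ncard

theorem ndeg_eq_degree (G : SimpleGraph V) (v : V) [Fintype (G.neighborSet v)] :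
    G.ndeg v = G.degree v := by
  rw [ndeg, Set.ncard_eq_toFinset_card', ← card_neighborFinset_eq_degree, neighborFinset]

theorem ndeg_mono [Finite V] {G H : SimpleGraph V} (h : H ≤ G) (v : V) : H.ndeg v ≤ G.ndeg v :=
  Set.ncard_le_ncard (fun _ hw => h hw) (Set.toFinite _)

/-- If `H ≤ G` has the same degree as `G` at `v`, it has the same neighbours. -/
theorem adj_of_ndeg_le [Finite V] {G H : SimpleGraph V} (h : H ≤ G) {v w : V}
    (hv : G.ndeg v ≤ H.ndeg v) (hvw : G.Adj v w) : H.Adj v w := by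
  have := Set.eq_of_subset_of_ncard_le (s := H.neighborSet v) (t := G.neighborSet v)
    (fun _ hw => h hw) hv (Set.toFinite _)
  exact this.symm.subset hvw

theorem ndeg_deleteEdges_singleton_add_one [Finite V] {G : SimpleGraph V} {a b : V}
    (hab : G.Adj a b) : (G.deleteEdges {s(a, b)}).ndeg a + 1 = G.ndeg a := by
  have : (G.deleteEdges {s(a, b)}).neighborSet a = G.neighborSet a \ {b} := by
    have := hab.ne
    ext z
    simp [deleteEdges_adj]
    tauto
  rw [ndeg, this, Set.ncard_sdiff_singleton_add_one (by simpa using hab) (Set.toFinite _), ndeg]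

theorem ndeg_deleteEdges_singleton_of_ne {G : SimpleGraph V} {a b v : V} (ha : v ≠ a)
    (hb : v ≠ b) : (G.deleteEdges {s(a, b)}).ndeg v = G.ndeg v := by
  have : (G.deleteEdges {s(a, b)}).neighborSet v = G.neighborSet v := by
    ext z
    simp [deleteEdges_adj, ha, hb]
  rw [ndeg, this, ndeg]

/-- The set of vertices of degree `k`. -/
def majors (G : SimpleGraph V) (k : ℕ) : Set V := {v | G.ndeg v = k}

@[simp]
theorem mem_majors {G : SimpleGraph V} {k : ℕ} {v : V} : v ∈ G.majors k ↔ G.ndeg v = k := Iff.rfl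

theorem majors_deleteEdges_singleton [Finite V] {G : SimpleGraph V} {k : ℕ} {a b : V}
    (hab : G.Adj a b) (ha : a ∈ G.majors k) (hb : b ∈ G.majors k) :
    (G.deleteEdges {s(a, b)}).majors k = G.majors k \ {a, b} := by
  ext v
  simp only [mem_majors, Set.mem_sdiff, Set.mem_insert_iff, Set.mem_singleton_iff, not_or] at *
  have h1 := ndeg_deleteEdges_singleton_add_one hab
  have h2 := ndeg_deleteEdges_singleton_add_one hab.symm
  rw [Sym2.eq_swap] at h2
  by_cases hva : v = a
  · subst hva
    simp only [not_true, false_and, and_false, iff_false]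
    omega
  by_cases hvb : v = b
  · subst hvb
    simp only [not_true, and_false, iff_false]
    omega
  rw [ndeg_deleteEdges_singleton_of_ne hva hvb]
  tauto

theorem ncard_majors_deleteEdges_singleton [Finite V] {G : SimpleGraph V} {k : ℕ} {a b : V}
    (hab : G.Adj a b) (ha : a ∈ G.majors k) (hb : b ∈ G.majors k) :
    ((G.deleteEdges {s(a, b)}).majors k).ncard + 2 = (G.majors k).ncard := by
  rw [majors_deleteEdges_singleton hab ha hb, ← Set.ncard_pair hab.ne]
  exact Set.ncard_sdiff_add_ncard_of_subset (by
    rintro v (rfl | rfl) <;> assumption) (Set.toFinite _)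

/-- A graph of maximum degree at most `k` without a proper edge colouring with `k` colours has a
critical subgraph, in which Vizing's adjacency lemma holds for all edges. -/
theorem exists_critical_subgraph [Finite V] {k : ℕ} (hk : k ≠ 0) (G : SimpleGraph V)
    (hG : ¬ G.EdgeColorable k) (hdeg : ∀ v, G.ndeg v ≤ k) :
    ∃ H ≤ G, (∃ x y, H.Adj x y) ∧ ∀ x y, H.Adj x y →
      k + 1 ≤ H.ndeg y + (H.majors k ∩ (H.neighborSet x \ {y})).ncard := by
  classical
  have := Fintype.ofFinite V
  obtain ⟨H, ⟨hHG, hH⟩, hmin⟩ := Set.Finite.exists_minimal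
    (s := {H : SimpleGraph V | H ≤ G ∧ ¬ H.EdgeColorable k}) (Set.toFinite _) ⟨G, le_rfl, hG⟩
  have hHdeg : ∀ v, H.degree v ≤ k := fun v =>
    (H.ndeg_eq_degree v).symm.le.trans ((ndeg_mono hHG v).trans (hdeg v))
  refine ⟨H, hHG, ?_, fun x y hxy => ?_⟩
  · by_contra! h
    have : H = ⊥ := by
      ext x y
      simp [h]
    exact hH (this ▸ edgeColorable_bot hk)
  · have hcol : (H.deleteEdges {s(x, y)}).EdgeColorable k := by
      by_contra hc
      have h1 := hmin ⟨(deleteEdges_le _).trans hHG, hc⟩ (deleteEdges_le _)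
      have := h1 hxy
      simp [deleteEdges_adj] at this
    refine (le_degree_add_card_major H hxy hH hcol (hHdeg x)).trans ?_
    rw [ndeg_eq_degree, ← Set.ncard_coe_finset]
    refine Nat.add_le_add_left (Set.ncard_le_ncard (fun z hz => ?_) (Set.toFinite _)) _
    simp only [Finset.coe_filter, Finset.mem_erase, mem_neighborFinset, Set.mem_ofPred_eq] at hz
    exact ⟨(H.ndeg_eq_degree z).trans (le_antisymm (hHdeg z) hz.2), hz.1.2, hz.1.1⟩

/-- In a critical graph every neighbour `x` of a vertex `y` has a neighbour of maximum degree other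
than `y`. -/
theorem exists_adj_major {k : ℕ} {H : SimpleGraph V} {x y : V} (hy : H.ndeg y ≤ k)
    (h : k + 1 ≤ H.ndeg y + (H.majors k ∩ (H.neighborSet x \ {y})).ncard) :
    ∃ z ∈ H.majors k, H.Adj x z ∧ z ≠ y := by
  obtain ⟨z, hz, hxz, hzy⟩ := Set.nonempty_of_ncard_ne_zero
    (s := H.majors k ∩ (H.neighborSet x \ {y})) (by omega)
  exact ⟨z, hz, hxz, hzy⟩

/-- In a critical graph every non-isolated vertex has two neighbours of maximum degree. -/
theorem exists_adj_two_majors {k : ℕ} {H : SimpleGraph V} (hdeg : ∀ v, H.ndeg v ≤ k)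
    (h : ∀ x y, H.Adj x y →
      k + 1 ≤ H.ndeg y + (H.majors k ∩ (H.neighborSet x \ {y})).ncard) {x y : V}
    (hxy : H.Adj x y) :
    ∃ z ∈ H.majors k, ∃ z' ∈ H.majors k, z ≠ z' ∧ H.Adj x z ∧ H.Adj x z' := by
  obtain ⟨z, hz, hxz, -⟩ := exists_adj_major (hdeg y) (h x y hxy)
  obtain ⟨z', hz', hxz', hne⟩ := exists_adj_major (hdeg z) (h x z hxz)
  exact ⟨z, hz, z', hz', hne.symm, hxz, hxz'⟩

/-- The vertices of maximum degree of a critical graph contain a path on three vertices. -/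
theorem exists_three_majors {k : ℕ} {H : SimpleGraph V}
    (hdeg : ∀ v, H.ndeg v ≤ k)
    (hne : ∃ x y, H.Adj x y)
    (h : ∀ x y, H.Adj x y →
      k + 1 ≤ H.ndeg y + (H.majors k ∩ (H.neighborSet x \ {y})).ncard) :
    ∃ a ∈ H.majors k, ∃ b ∈ H.majors k, ∃ c ∈ H.majors k, b ≠ c ∧ H.Adj a b ∧ H.Adj a c := by
  obtain ⟨x, y, hxy⟩ := hne
  obtain ⟨a, ha, hxa, -⟩ := exists_adj_major (hdeg y) (h x y hxy)
  obtain ⟨b, hb, c, hc, hbc, hab, hac⟩ := exists_adj_two_majors hdeg h hxa.symm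
  exact ⟨a, ha, b, hb, c, hc, hbc, hab, hac⟩

/-- The path is found in a critical subgraph; since degrees in `G` are at most `k`, a vertex of
degree `k` there also has degree `k` in `G`. -/
theorem exists_three_majors_of_not_edgeColorable [Finite V] {k : ℕ} (hk : k ≠ 0)
    {G : SimpleGraph V} (hG : ¬ G.EdgeColorable k) (hdeg : ∀ v, G.ndeg v ≤ k) :
    ∃ a ∈ G.majors k, ∃ b ∈ G.majors k, ∃ c ∈ G.majors k, b ≠ c ∧ G.Adj a b ∧ G.Adj a c := by
  obtain ⟨H, hHG, hne, h⟩ := exists_critical_subgraph hk G hG hdeg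
  have hHdeg : ∀ v, H.ndeg v ≤ k := fun v => (ndeg_mono hHG v).trans (hdeg v)
  have hmaj : ∀ v ∈ H.majors k, v ∈ G.majors k := fun v hv =>
    le_antisymm (hdeg v) ((mem_majors.1 hv).symm.le.trans (ndeg_mono hHG v))
  obtain ⟨a, ha, b, hb, c, hc, hbc, hab, hac⟩ := exists_three_majors hHdeg hne h
  exact ⟨a, hmaj a ha, b, hmaj b hb, c, hmaj c hc, hbc, hHG hab, hHG hac⟩

theorem three_le_ncard_majors [Finite V] {k : ℕ} (hk : k ≠ 0)
    {G : SimpleGraph V} (hG : ¬ G.EdgeColorable k) (hdeg : ∀ v, G.ndeg v ≤ k) :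
    3 ≤ (G.majors k).ncard := by
  obtain ⟨a, ha, b, hb, c, hc, hbc, hab, hac⟩ := exists_three_majors_of_not_edgeColorable hk hG hdeg
  rw [← Set.ncard_eq_three.2 ⟨a, b, c, hab.ne, hac.ne, hbc, rfl⟩]
  refine Set.ncard_le_ncard ?_ (Set.toFinite _)
  rintro v (rfl | rfl | rfl) <;> assumption

/-! ### The upper bound -/

theorem edgeSet_insert_deleteEdges {G : SimpleGraph V} {e : Sym2 V} (he : e ∈ G.edgeSet)
    {F : Set (Sym2 V)} (hF : F ⊆ (G.deleteEdges {e}).edgeSet) : insert e F ⊆ G.edgeSet := by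
  refine Set.insert_subset he fun f hf => ?_
  have := hF hf
  rw [edgeSet_deleteEdges] at this
  exact this.1

/-- A graph with `t` vertices of maximum degree `k` can be made edge `k`-colourable by removing fewer
than `t / 2` edges, unless it is edge `k`-colourable already. -/
theorem exists_deleteEdges_edgeColorable [Finite V] {k : ℕ} (hk : k ≠ 0) (G : SimpleGraph V)
    (hG : ¬ G.EdgeColorable k) (hdeg : ∀ v, G.ndeg v ≤ k) :
    ∃ F : Finset (Sym2 V), (F : Set (Sym2 V)) ⊆ G.edgeSet ∧
      2 * F.card + 1 ≤ (G.majors k).ncard ∧ (G.deleteEdges F).EdgeColorable k := by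
  classical
  induction h : (G.majors k).ncard using Nat.strong_induction_on generalizing G with
  | _ t ih =>
    obtain ⟨a, ha, b, hb, -, -, -, hab, -⟩ := exists_three_majors_of_not_edgeColorable hk hG hdeg
    -- The bound 3 is available at every stage that is not yet colourable; at the last deletion it
    -- supplies the `+ 1` in the estimate.
    have ht := three_le_ncard_majors hk hG hdeg
    have hcard := ncard_majors_deleteEdges_singleton hab ha hb
    by_cases hcol : (G.deleteEdges {s(a, b)}).EdgeColorable k
    · exact ⟨{s(a, b)}, by simpa using hab, by simp; omega, by simpa using hcol⟩
    · obtain ⟨F, hF, hFc, hFcol⟩ := ih _ (by omega) _ hcol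
        (fun v => (ndeg_mono (deleteEdges_le _) v).trans (hdeg v)) rfl
      refine ⟨insert s(a, b) F, ?_, ?_, ?_⟩
      · rw [Finset.coe_insert]
        exact edgeSet_insert_deleteEdges hab hF
      · have := Finset.card_insert_le s(a, b) F
        omega
      · rwa [Finset.coe_insert, Set.insert_eq, ← deleteEdges_deleteEdges]

/-! ### Perfect matchings and their removal -/

/-- A graph on an even number `n` of vertices with minimum degree at least `n / 2` has a perfect
matching, given here as an involution. -/
theorem exists_involutive_adj_of_le_two_mul_degree [Fintype V] (G : SimpleGraph V)
    [DecidableRel G.Adj] (heven : Even (Fintype.card V))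
    (hdeg : ∀ v, Fintype.card V ≤ 2 * G.degree v) :
    ∃ σ : V → V, Function.Involutive σ ∧ ∀ v, G.Adj v (σ v) := by
  classical
  let s : Set (V → V) := {σ | Function.Involutive σ ∧ ∀ v, σ v ≠ v → G.Adj v (σ v)}
  let fx : (V → V) → Finset V := fun σ => Finset.univ.filter fun v => σ v = v
  -- Matchings are encoded as involutions whose fixed points are the unmatched vertices; take one
  -- with the fewest.
  obtain ⟨σ, ⟨hσ, hσa⟩, hmin⟩ := Set.exists_min_image s (fun σ => (fx σ).card) (Set.toFinite _)
    ⟨id, fun _ => rfl, fun v h => absurd rfl h⟩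
  refine ⟨σ, hσ, ?_⟩
  by_contra! hne
  obtain ⟨u, hu⟩ := hne
  have huσ : σ u = u := by
    by_contra h
    exact hu (hσa u h)
  have hpar : Even (fx σ).card := by
    have h1 := Equiv.Perm.card_fixedPoints_modEq (α := V) (f := (σ : Function.End V)) (p := 2)
      (n := 1) (by
        funext v
        exact hσ v)
    have h2 : Fintype.card (Function.fixedPoints σ) = (fx σ).card := by
      rw [← Set.toFinset_card]
      congr 1
      ext v
      simp [fx, Function.IsFixedPt]
    rw [Nat.even_iff, ← h2, ← Nat.even_iff.1 heven]
    exact h1.symm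
  have huf : u ∈ fx σ := by simp [fx, huσ]
  obtain ⟨u', hu'f, huu'⟩ : ∃ u' ∈ fx σ, u' ≠ u := by
    refine Finset.exists_mem_ne ?_ u
    have := Finset.card_pos.2 ⟨u, huf⟩
    obtain ⟨m, hm⟩ := hpar
    omega
  have hu'σ : σ u' = u' := by simpa [fx] using hu'f
  have hfix : ∀ u v, σ u = u → σ v = v → ¬ G.Adj u v := by
    intro u v hu hv huv
    have hne := huv.ne
    let τ : V → V := fun w => if w = u then v else if w = v then u else σ w
    have hτ : τ ∈ s := by
      refine ⟨fun w => ?_, fun w hw => ?_⟩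
      · have := hσ w
        have := hσ u
        have := hσ v
        simp only [τ]
        grind
      · have := hσa w
        have := huv.symm
        simp only [τ] at hw ⊢
        grind
    have hlt : (fx τ).card < (fx σ).card := by
      refine Finset.card_lt_card (Finset.ssubset_iff_of_subset ?_ |>.2 ⟨u, ?_, ?_⟩)
      · intro w hw
        simp only [fx, τ, Finset.mem_filter, Finset.mem_univ, true_and] at hw ⊢
        grind
      · simpa [fx] using hu
      · simpa [fx, τ] using hne.symm
    exact absurd (hmin τ hτ) (by simpa using hlt)
  -- Otherwise `u`, `x`, `σ x`, `u'` is an augmenting path.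
  have hcross : ∀ x, G.Adj u x → ¬ G.Adj u' (σ x) := by
    intro x hux hux'
    have hxσ : σ x ≠ x := fun h => hfix u x huσ h hux
    have h1 := hux.ne
    have h2 := hux'.ne
    have h3 : x ≠ u' := fun h => hxσ (by rw [h, hu'σ])
    have h4 : σ x ≠ u := fun h => hux.ne (by rw [← huσ, ← h, hσ x])
    let τ : V → V := fun w => if w = u then x else if w = x then u else
      if w = u' then σ x else if w = σ x then u' else σ w
    have hτ : τ ∈ s := by
      refine ⟨fun w => ?_, fun w hw => ?_⟩
      · have := hσ w
        have := hσ x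
        simp only [τ]
        grind
      · have := hσa w
        have := hux.symm
        have := hux'.symm
        simp only [τ] at hw ⊢
        grind
    have hlt : (fx τ).card < (fx σ).card := by
      refine Finset.card_lt_card (Finset.ssubset_iff_of_subset ?_ |>.2 ⟨u, ?_, ?_⟩)
      · intro w hw
        simp only [fx, τ, Finset.mem_filter, Finset.mem_univ, true_and] at hw ⊢
        grind
      · simpa [fx] using huσ
      · simpa [fx, τ] using h1.symm
    exact absurd (hmin τ hτ) (by simpa using hlt)
  -- The sets `σ (N(u))` and `N(u')` are disjoint and avoid `u`, so the degrees of `u` and `u'` sum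
  -- to at most |V| - 1, against the degree hypothesis.
  have hdisj : Disjoint ((G.neighborFinset u).image σ) (G.neighborFinset u') := by
    rw [Finset.disjoint_left]
    intro z hz hz'
    obtain ⟨x, hx, rfl⟩ := Finset.mem_image.1 hz
    exact hcross x (by simpa using hx) (by simpa using hz')
  have hsub : (G.neighborFinset u).image σ ∪ G.neighborFinset u' ⊆ (Finset.univ.erase u) := by
    intro z hz
    refine Finset.mem_erase.2 ⟨?_, Finset.mem_univ _⟩
    rintro rfl
    rcases Finset.mem_union.1 hz with hz | hz
    · obtain ⟨x, hx, hxz⟩ := Finset.mem_image.1 hz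
      rw [mem_neighborFinset] at hx
      exact hx.ne (by rw [← hσ x, hxz, huσ])
    · exact hfix u' z hu'σ huσ (by simpa using hz)
  have hcard := Finset.card_le_card hsub
  rw [Finset.card_union_of_disjoint hdisj, Finset.card_image_of_injective _ hσ.injective,
    card_neighborFinset_eq_degree, card_neighborFinset_eq_degree,
    Finset.card_erase_of_mem (Finset.mem_univ _), Finset.card_univ] at hcard
  have := hdeg u
  have := hdeg u'
  have := Fintype.card_pos_iff.2 ⟨u⟩
  omega

theorem degree_eq_card_filter_add_card_filter_compl [Fintype V] [DecidableEq V] (G : SimpleGraph V)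
    [DecidableRel G.Adj] (T : Finset V) (v : V) :
    G.degree v = (T.filter (G.Adj v)).card + (Tᶜ.filter (G.Adj v)).card := by
  rw [← card_neighborFinset_eq_degree, neighborFinset_eq_filter,
    ← Finset.card_union_of_disjoint (Finset.disjoint_filter_filter disjoint_compl_right),
    ← Finset.filter_union, Finset.union_compl]

/-- A perfect matching of the graph induced outside `T`, as an involution of all vertices. -/
theorem exists_involutive_adj_compl [Fintype V] [DecidableEq V] (G : SimpleGraph V)
    [DecidableRel G.Adj] (T : Finset V) (heven : Even (Tᶜ).card)
    (hdeg : ∀ v ∉ T, (Tᶜ).card ≤ 2 * (Tᶜ.filter (G.Adj v)).card) :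
    ∃ σ : V → V, Function.Involutive σ ∧ (∀ v ∈ T, σ v = v) ∧
      ∀ v ∉ T, σ v ∉ T ∧ G.Adj v (σ v) := by
  classical
  let Q : Set V := {v | v ∉ T}
  have hQ : Fintype.card Q = (Tᶜ).card := by
    rw [Fintype.card_subtype]
    congr 1
    ext v
    simp [Q]
  obtain ⟨σ, hσ, hσa⟩ := (G.induce Q).exists_involutive_adj_of_le_two_mul_degree
    (by rwa [hQ]) fun v => by
      rw [hQ]
      refine (hdeg v v.2).trans (Nat.mul_le_mul_left 2 ?_)
      rw [← card_neighborFinset_eq_degree]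
      refine Finset.card_le_card_of_surjOn (fun w => (w : V)) ?_
      intro w hw
      simp only [Finset.coe_filter, Finset.mem_compl, Set.mem_ofPred_eq] at hw
      exact ⟨⟨w, hw.1⟩, by simpa using hw.2, rfl⟩
  refine ⟨fun v => if h : v ∈ T then v else σ ⟨v, h⟩, fun v => ?_, fun v hv => dif_pos hv,
    fun v hv => ?_⟩
  · by_cases hv : v ∈ T
    · simp [hv]
    · have h1 : (σ ⟨v, hv⟩ : V) ∉ T := (σ ⟨v, hv⟩).2
      simp only [hv, dif_neg, not_false_iff, h1]
      exact congrArg Subtype.val (hσ ⟨v, hv⟩)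
  · have h1 : (σ ⟨v, hv⟩ : V) ∉ T := (σ ⟨v, hv⟩).2
    simp only [hv, dif_neg, not_false_iff, h1, true_and]
    exact hσa ⟨v, hv⟩

/-- The graph without the edges joining `v` and `τ v`. -/
def deleteInvolution (G : SimpleGraph V) (τ : V → V) (hτ : Function.Involutive τ) :
    SimpleGraph V where
  Adj u v := G.Adj u v ∧ v ≠ τ u
  symm := ⟨fun u v h => ⟨h.1.symm, fun h' => h.2 (by rw [h', hτ])⟩⟩
  loopless := ⟨fun u h => G.loopless.irrefl u h.1⟩

theorem deleteInvolution_le (G : SimpleGraph V) {τ : V → V} (hτ : Function.Involutive τ) :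
    G.deleteInvolution τ hτ ≤ G := fun _ _ h => h.1

/-- The deleted edges form a matching, so one extra colour serves them all. -/
theorem EdgeColorable.of_deleteInvolution {G : SimpleGraph V} {τ : V → V}
    {hτ : Function.Involutive τ} {k : ℕ} (h : (G.deleteInvolution τ hτ).EdgeColorable k) :
    G.EdgeColorable (k + 1) := by
  classical
  obtain ⟨φ, hφ⟩ := h
  let ψ : Sym2 V → Fin (k + 1) := fun e => if ∃ v, e = s(v, τ v) then Fin.last k else (φ e).castSucc
  have hψ : ∀ u v, ψ s(u, v) = if v = τ u then Fin.last k else (φ s(u, v)).castSucc := by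
    intro u v
    have : (∃ w, s(u, v) = s(w, τ w)) ↔ v = τ u := by
      constructor
      · rintro ⟨w, hw⟩
        rcases Sym2.eq_iff.1 hw with ⟨rfl, rfl⟩ | ⟨rfl, rfl⟩
        · rfl
        · rw [hτ]
      · rintro rfl
        exact ⟨u, rfl⟩
    simp only [ψ, this]
  refine ⟨ψ, fun u v w hv hw heq => ?_⟩
  rw [hψ, hψ] at heq
  split_ifs at heq with h1 h2 h2
  · rw [h1, h2]
  · exact absurd heq.symm (Fin.castSucc_lt_last _).ne
  · exact absurd heq (Fin.castSucc_lt_last _).ne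
  · exact hφ u v w ⟨hv, h1⟩ ⟨hw, h2⟩ (Fin.castSucc_injective _ heq)

theorem ndeg_deleteInvolution_add_one [Finite V] {G : SimpleGraph V} {τ : V → V}
    (hτ : Function.Involutive τ) {v : V} (hv : G.Adj v (τ v)) :
    (G.deleteInvolution τ hτ).ndeg v + 1 = G.ndeg v := by
  have : (G.deleteInvolution τ hτ).neighborSet v = G.neighborSet v \ {τ v} := rfl
  rw [ndeg, this, Set.ncard_sdiff_singleton_add_one (by simpa using hv) (Set.toFinite _), ndeg]

/-! ### Three vertices of maximum degree: the Chetwynd–Hilton theorem -/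

/-- The structure of connected graphs with three vertices of maximum degree `k` that have no proper
edge colouring with `k` colours, as far as it follows from Vizing's adjacency lemma. -/
theorem structure_of_ncard_majors_eq_three [Finite V] {k : ℕ} (hk : k ≠ 0) {G : SimpleGraph V}
    (hG : ¬ G.EdgeColorable k) (hdeg : ∀ v, G.ndeg v ≤ k) (hconn : G.Connected)
    (h3 : (G.majors k).ncard = 3) :
    (∀ a ∈ G.majors k, ∀ b ∈ G.majors k, a ≠ b → G.Adj a b) ∧ (∀ v, k ≤ G.ndeg v + 1) ∧
    ∀ v, ∃ z ∈ G.majors k, ∃ z' ∈ G.majors k, z ≠ z' ∧ G.Adj v z ∧ G.Adj v z' := by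
  obtain ⟨H, hHG, hne, h⟩ := exists_critical_subgraph hk G hG hdeg
  have hHdeg : ∀ v, H.ndeg v ≤ k := fun v => (ndeg_mono hHG v).trans (hdeg v)
  have hsub : H.majors k ⊆ G.majors k := fun v hv =>
    le_antisymm (hdeg v) ((mem_majors.1 hv).symm.le.trans (ndeg_mono hHG v))
  obtain ⟨a, ha, b, hb, c, hc, hbc, hab, hac⟩ := exists_three_majors hHdeg hne h
  have hmaj : H.majors k = G.majors k := by
    refine Set.eq_of_subset_of_ncard_le hsub ?_ (Set.toFinite _)
    rw [h3, ← Set.ncard_eq_three.2 ⟨a, b, c, hab.ne, hac.ne, hbc, rfl⟩]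
    refine Set.ncard_le_ncard ?_ (Set.toFinite _)
    rintro v (rfl | rfl | rfl) <;> assumption
  -- Apply the adjacency lemma to an edge from a major `x` to `y`: only two majors other than `x`
  -- exist, so `y` has degree at least `k + 1 - 2`.
  have hHdeg' : ∀ v w, H.Adj v w → k ≤ H.ndeg v + 1 := by
    intro y w hyw
    obtain ⟨x, hx, hyx, -⟩ := exists_adj_major (hHdeg w) (h y w hyw)
    have h1 := h x y hyx.symm
    have h2 : (H.majors k ∩ (H.neighborSet x \ {y})).ncard ≤ (H.majors k \ {x}).ncard := by
      refine Set.ncard_le_ncard (fun z hz => ⟨hz.1, ?_⟩) (Set.toFinite _)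
      rintro rfl
      exact H.loopless.irrefl _ hz.2.1
    have h4 := Set.ncard_sdiff_singleton_add_one hx (Set.toFinite _)
    rw [hmaj] at h1 h2 h4
    omega
  -- A vertex not isolated in `H` has equal degrees in `H` and `G`: both are `k` or both are `k -
  -- 1`. By connectedness no vertex is isolated in `H`.
  have hGH : ∀ v w, H.Adj v w → ∀ u, G.Adj v u → H.Adj v u := by
    intro v w hvw u hvu
    refine adj_of_ndeg_le hHG ?_ hvu
    by_cases hv : v ∈ G.majors k
    · rw [mem_majors.1 hv, mem_majors.1 (hmaj ▸ hv : v ∈ H.majors k)]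
    · have h1 := hHdeg' v w hvw
      have h2 := hdeg v
      rw [mem_majors] at hv
      omega
  have hnbr : ∀ v, ∃ w, H.Adj v w := by
    intro v
    obtain ⟨p⟩ := hconn.preconnected a v
    have hwalk : ∀ u v, G.Walk u v → (∃ w, H.Adj u w) → ∃ w, H.Adj v w := by
      intro u v p
      induction p with
      | nil => exact id
      | cons hadj _ ih =>
        rintro ⟨w, hw⟩
        exact ih ⟨_, (hGH _ w hw _ hadj).symm⟩
    exact hwalk a v p ⟨b, hab⟩
  refine ⟨?_, ?_, ?_⟩
  · intro x hx y hy hxy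
    obtain ⟨w, hw⟩ := hnbr x
    obtain ⟨z, hz, z', hz', hzz', hxz, hxz'⟩ := exists_adj_two_majors hHdeg h hw
    by_contra hadj
    -- If `y` were not adjacent to `x`, then `x`, its two major neighbours and `y` would be four
    -- majors.
    have h1 : ({x, z, z', y} : Set V) ⊆ G.majors k := by
      rintro v (rfl | rfl | rfl | rfl)
      · exact hx
      · exact hsub hz
      · exact hsub hz'
      · exact hy
    have h2 := Set.ncard_le_ncard h1 (Set.toFinite _)
    have h5 : z ≠ y := fun h => hadj (h ▸ hHG hxz)
    have h6 : z' ≠ y := fun h => hadj (h ▸ hHG hxz')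
    have h4 : ({x, z, z', y} : Set V).ncard = 4 := by
      rw [Set.ncard_insert_of_notMem, Set.ncard_eq_three.2 ⟨z, z', y, hzz', h5, h6, rfl⟩]
      simp [hxz.ne, hxz'.ne, hxy]
    omega
  · intro v
    obtain ⟨w, hw⟩ := hnbr v
    exact (hHdeg' v w hw).trans (Nat.add_le_add_right (ndeg_mono hHG v) 1)
  · intro v
    obtain ⟨w, hw⟩ := hnbr v
    obtain ⟨z, hz, z', hz', hzz', hxz, hxz'⟩ := exists_adj_two_majors hHdeg h hw
    exact ⟨z, hsub hz, z', hsub hz', hzz', hHG hxz, hHG hxz'⟩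

/-- The reduction step for three vertices `r`, `r'`, `s` of maximum degree: a perfect matching of the
remaining vertices, changed at an edge `w (σ w)` with `w` not adjacent to `s`, can be removed from
`G` together with `r' s` and `r (σ w)`, which leaves an edge `(k - 1)`-colourable graph. -/
theorem edgeColorable_of_involutive [Finite V] {k : ℕ} (hk : 1 < k) {G : SimpleGraph V}
    (hdeg : ∀ v, G.ndeg v ≤ k) {r r' s w : V} (hT : G.majors k ⊆ {r, r', s}) (hrs : G.Adj r s)
    (hr's : G.Adj r' s) (hrr' : r ≠ r') (hws : ¬ G.Adj s w) {σ : V → V}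
    (hσ : Function.Involutive σ) (hσT : ∀ v ∈ ({r, r', s} : Set V), σ v = v)
    (hσa : ∀ v ∉ ({r, r', s} : Set V), G.Adj v (σ v)) (hw : w ∉ ({r, r', s} : Set V))
    (hwr : G.Adj r (σ w)) : G.EdgeColorable k := by
  classical
  by_contra hG
  have hσr := hσT r (by simp)
  have hσr' := hσT r' (by simp)
  have hσs := hσT s (by simp)
  simp only [Set.mem_insert_iff, Set.mem_singleton_iff, not_or] at hw hσa
  obtain ⟨hwr0, hwr', hws0⟩ := hw
  have hw' := hσa w ⟨hwr0, hwr', hws0⟩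
  -- Reroute `σ`: leave `w` unmatched, match its former partner with `r`, and match `r'` with `s`.
  let τ : V → V := fun v => if v = w then w else if v = σ w then r else if v = r then σ w else
    if v = r' then s else if v = s then r' else σ v
  have hrs' := hrs.ne
  have hr's' := hr's.ne
  have hwne := hw'.ne
  have hσw := hσ w
  have h1 : σ w ≠ r := fun h => hwr0 (by rw [← hσw, h, hσr])
  have h2 : σ w ≠ r' := fun h => hwr' (by rw [← hσw, h, hσr'])
  have h3 : σ w ≠ s := fun h => hws0 (by rw [← hσw, h, hσs])
  have hτw : τ w = w := by simp [τ]
  have hτσw : τ (σ w) = r := by simp [τ, hwne.symm]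
  have hτr : τ r = σ w := by simp [τ, Ne.symm hwr0, h1.symm]
  have hτr' : τ r' = s := by simp [τ, Ne.symm hwr', h2.symm, hrr'.symm]
  have hτs : τ s = r' := by simp [τ, Ne.symm hws0, h3.symm, hrs'.symm, hr's'.symm]
  have hτo : ∀ v, v ≠ w → v ≠ σ w → v ≠ r → v ≠ r' → v ≠ s → τ v = σ v := by
    intro v hv1 hv2 hv3 hv4 hv5
    simp [τ, hv1, hv2, hv3, hv4, hv5]
  have hcases : ∀ v, v = w ∨ v = σ w ∨ v = r ∨ v = r' ∨ v = s ∨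
      (v ≠ w ∧ v ≠ σ w ∧ v ≠ r ∧ v ≠ r' ∧ v ≠ s) := by
    intro v
    tauto
  have hτ : Function.Involutive τ := by
    intro v
    rcases hcases v with rfl | rfl | rfl | rfl | rfl | ⟨hv1, hv2, hv3, hv4, hv5⟩
    · rw [hτw, hτw]
    · rw [hτσw, hτr]
    · rw [hτr, hτσw]
    · rw [hτr', hτs]
    · rw [hτs, hτr']
    · have hσv := hσ v
      rw [hτo v hv1 hv2 hv3 hv4 hv5, hτo (σ v), hσv]
      · exact fun h => hv2 (by rw [← hσv, h])
      · exact fun h => hv1 (hσ.injective h)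
      · exact fun h => hv3 (by rw [← hσv, h, hσr])
      · exact fun h => hv4 (by rw [← hσv, h, hσr'])
      · exact fun h => hv5 (by rw [← hσv, h, hσs])
  have hτa : ∀ v, v ≠ w → G.Adj v (τ v) := by
    intro v hv
    rcases hcases v with rfl | rfl | rfl | rfl | rfl | ⟨hv1, hv2, hv3, hv4, hv5⟩
    · exact absurd rfl hv
    · rw [hτσw]
      exact hwr.symm
    · rw [hτr]
      exact hwr
    · rw [hτr']
      exact hr's
    · rw [hτs]
      exact hr's.symm
    · rw [hτo v hv1 hv2 hv3 hv4 hv5]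
      exact hσa v ⟨hv3, hv4, hv5⟩
  let G' := G.deleteInvolution τ hτ
  have hG' : ¬ G'.EdgeColorable (k - 1) := fun h => hG (by
    have := h.of_deleteInvolution
    rwa [Nat.sub_add_cancel hk.le] at this)
  have hdeg' : ∀ v, v ≠ w → G'.ndeg v + 1 = G.ndeg v := fun v hv =>
    ndeg_deleteInvolution_add_one hτ (hτa v hv)
  have hG'deg : ∀ v, G'.ndeg v ≤ k - 1 := by
    intro v
    by_cases hv : v = w
    · have h4 : w ∉ G.majors k := fun h => by
        have := hT h
        simp [hwr0, hwr', hws0] at this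
      have h5 := ndeg_mono (G.deleteInvolution_le hτ) w
      have h6 := hdeg w
      rw [mem_majors] at h4
      rw [hv]
      exact h5.trans (by omega)
    · have := hdeg' v hv
      have := hdeg v
      omega
  obtain ⟨H, hHG, hne, h⟩ := exists_critical_subgraph (by omega) G' hG' hG'deg
  have hHdeg : ∀ v, H.ndeg v ≤ k - 1 := fun v => (ndeg_mono hHG v).trans (hG'deg v)
  have hmaj : ∀ v ∈ H.majors (k - 1), v = r ∨ v = r' ∨ v = s ∨ v = w := by
    intro v hv
    by_cases hvw : v = w
    · simp [hvw]
    have h4 := hdeg' v hvw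
    have h5 := ndeg_mono hHG v
    rw [mem_majors] at hv
    have h6 : v ∈ G.majors k := le_antisymm (hdeg v) (by omega)
    have := hT h6
    simp only [Set.mem_insert_iff, Set.mem_singleton_iff] at this
    tauto
  -- Among the possible majors `r`, `r'`, `s`, `w` of `H`, only `r` can be a neighbour of `s`: the
  -- edge `r's` was removed and `w` is not adjacent to `s`. A non-isolated vertex would need two.
  have hs : ∀ v, ¬ H.Adj s v := by
    intro v hv
    obtain ⟨z, hz, z', hz', hzz', hsz, hsz'⟩ := exists_adj_two_majors hHdeg h hv
    have hr : ∀ z ∈ H.majors (k - 1), H.Adj s z → z = r := by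
      intro z hz hsz
      rcases hmaj z hz with rfl | rfl | rfl | rfl
      · rfl
      · exact absurd hτs.symm (hHG hsz).2
      · exact absurd rfl hsz.ne
      · exact absurd (hHG hsz).1 hws
    exact hzz' ((hr z hz hsz).trans (hr z' hz' hsz').symm)
  obtain ⟨a, ha, b, hb, c, hc, hbc, hab, hac⟩ := exists_three_majors hHdeg hne h
  have hnes : ∀ v u, H.Adj v u → v ≠ s := fun v u hvu hvs => hs u (hvs ▸ hvu)
  -- The three majors on a path in `H` are not `s`, hence are `r`, `r'`, `w`. Then `r` keeps all its
  -- edges in `H`, including the one to the isolated `s`.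
  have hrH : r ∈ H.majors (k - 1) := by
    have := hnes a b hab
    have := hnes b a hab.symm
    have := hnes c a hac.symm
    have := hab.ne
    have := hac.ne
    have := hmaj a ha
    have := hmaj b hb
    have := hmaj c hc
    grind
  have hrsH : H.Adj r s := by
    refine adj_of_ndeg_le hHG ?_ ⟨hrs, ?_⟩
    · rw [mem_majors.1 hrH]
      exact hG'deg r
    · rw [hτr]
      exact h3.symm
  exact hs r hrsH.symm

/-- Chetwynd and Hilton: a connected graph with three vertices of maximum degree `k` that has no
proper edge colouring with `k` colours has `k + 1` vertices, and `k` is even. -/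
theorem card_eq_of_ncard_majors_eq_three [Finite V] {k : ℕ} (hk : k ≠ 0) {G : SimpleGraph V}
    (hG : ¬ G.EdgeColorable k) (hdeg : ∀ v, G.ndeg v ≤ k) (hconn : G.Connected)
    (h3 : (G.majors k).ncard = 3) : Nat.card V = k + 1 ∧ Even k := by
  classical
  have := Fintype.ofFinite V
  obtain ⟨hclique, hlow, htwo⟩ := structure_of_ncard_majors_eq_three hk hG hdeg hconn h3
  obtain ⟨r₁, r₂, r₃, h12, h13, h23, hT⟩ := Set.ncard_eq_three.1 h3
  let T : Finset V := {r₁, r₂, r₃}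
  have hTT : G.majors k = T := by simp [T, hT]
  have hTc : T.card = 3 := Finset.card_eq_three.2 ⟨r₁, r₂, r₃, h12, h13, h23, rfl⟩
  have hdT : ∀ v, v ∈ T ↔ G.degree v = k := by
    intro v
    rw [← Finset.mem_coe, ← hTT, mem_majors, ndeg_eq_degree]
  simp only [ndeg_eq_degree] at hdeg hlow
  have hdQ : ∀ v ∉ T, G.degree v = k - 1 := by
    intro v hv
    rw [hdT] at hv
    have := hdeg v
    have := hlow v
    omega
  have hcl : ∀ a ∈ T, ∀ b ∈ T, a ≠ b → G.Adj a b := by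
    rw [hTT] at hclique
    exact_mod_cast hclique
  have htw : ∀ v, ∃ z ∈ T, ∃ z' ∈ T, z ≠ z' ∧ G.Adj v z ∧ G.Adj v z' := by
    rw [hTT] at htwo
    exact_mod_cast htwo
  have hm2 : ∀ v, 2 ≤ (T.filter (G.Adj v)).card := by
    intro v
    obtain ⟨z, hz, z', hz', hzz', hvz, hvz'⟩ := htw v
    rw [← Finset.card_pair hzz']
    refine Finset.card_le_card fun u hu => ?_
    rcases Finset.mem_insert.1 hu with rfl | hu
    · simp [hz, hvz]
    · rw [Finset.mem_singleton] at hu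
      simp [hu, hz', hvz']
  have hmT : ∀ v ∈ T, (T.filter (G.Adj v)).card = 2 := by
    intro v hv
    have : T.filter (G.Adj v) = T.erase v := by
      ext u
      simp only [Finset.mem_filter, Finset.mem_erase]
      constructor
      · exact fun h => ⟨h.2.ne', h.1⟩
      · exact fun h => ⟨h.2, hcl v hv u h.2 h.1.symm⟩
    rw [this, Finset.card_erase_of_mem hv, hTc]
  have hr₃ : r₃ ∈ T := by simp [T]
  have hdeg₃ := (hdT r₃).1 hr₃
  have hsplit := fun v => G.degree_eq_card_filter_add_card_filter_compl T v
  have hk2 : 2 ≤ k := by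
    have := hsplit r₃
    have := hm2 r₃
    omega
  have hN : Fintype.card V = 3 + (Tᶜ).card := by
    rw [← hTc, Finset.card_add_card_compl]
  have hkN : k < Fintype.card V := hdeg₃ ▸ G.degree_lt_card_verts r₃
  have hsum : 3 * k + (Tᶜ).card * (k - 1) = 2 * G.edgeFinset.card := by
    rw [← G.sum_degrees_eq_twice_card_edges, ← Finset.sum_add_sum_compl T,
      Finset.sum_congr rfl fun v hv => (hdT v).1 hv,
      Finset.sum_congr rfl fun v hv => hdQ v (Finset.mem_compl.1 hv)]
    simp [hTc]
  rw [Nat.card_eq_fintype_card]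
  obtain ⟨j, rfl⟩ : ∃ j, k = j + 1 := ⟨k - 1, by omega⟩
  rw [Nat.add_sub_cancel] at hsum
  have heven : Even (3 * (j + 1) + (Tᶜ).card * j) := hsum ▸ even_two_mul _
  by_cases hNk : Fintype.card V = j + 1 + 1
  · refine ⟨hNk, ?_⟩
    obtain ⟨i, rfl⟩ : ∃ i, j = i + 1 := ⟨j - 1, by omega⟩
    have : (Tᶜ).card = i := by omega
    rw [this] at heven
    simp only [Nat.even_add, Nat.even_mul, Nat.even_add_one] at heven ⊢
    have : ¬ Even 3 := by decide
    tauto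
  exfalso
  -- With `k = j + 1` odd, the degree sum `3k + |Tᶜ|(k - 1)` would be odd; for even `k` it forces
  -- |Tᶜ| to be even.
  have hje : Even (j + 1) := by
    by_contra hj
    have : ¬ Even 3 := by decide
    simp only [Nat.even_add, Nat.even_mul, Nat.even_add_one, Nat.even_add_one] at heven hj
    tauto
  have hqe : Even (Tᶜ).card := by
    have : ¬ Even 3 := by decide
    simp only [Nat.even_add, Nat.even_mul, Nat.even_add_one, Nat.even_add_one] at heven hje
    tauto
  -- Count the edges between `T` and its complement: each vertex of `T` sends out `k - 2 = j - 1` of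
  -- them.
  have hcount : ∑ v ∈ Tᶜ, (T.filter (G.Adj v)).card = 3 * (j - 1) := by
    have h4 := Finset.sum_card_bipartiteAbove_eq_sum_card_bipartiteBelow (s := T) (t := Tᶜ) G.Adj
    have h5 : ∀ v ∈ Tᶜ, (T.filter (G.Adj v)).card = (Finset.bipartiteBelow G.Adj T v).card := by
      intro v _
      congr 1
      ext u
      simp [Finset.bipartiteBelow, G.adj_comm]
    rw [Finset.sum_congr rfl h5, ← h4]
    have h6 : ∀ v ∈ T, (Finset.bipartiteAbove G.Adj Tᶜ v).card = j - 1 := by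
      intro v hv
      have h7 := hsplit v
      rw [hmT v hv, (hdT v).1 hv] at h7
      change (Tᶜ.filter (G.Adj v)).card = j - 1
      omega
    rw [Finset.sum_congr rfl h6, Finset.sum_const, hTc, smul_eq_mul]
  have hcount' : ∀ v ∉ T, 2 * (Tᶜ).card + ((T.filter (G.Adj v)).card - 2) ≤ 3 * (j - 1) := by
    intro v hv
    have hvQ := Finset.mem_compl.2 hv
    have h8 : 2 * ((Tᶜ).erase v).card ≤ ∑ u ∈ (Tᶜ).erase v, (T.filter (G.Adj u)).card := by
      rw [mul_comm, ← smul_eq_mul, ← Finset.sum_const]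
      exact Finset.sum_le_sum fun u _ => hm2 u
    rw [Finset.card_erase_of_mem hvQ] at h8
    rw [← hcount, ← Finset.add_sum_erase _ _ hvQ]
    have := hm2 v
    omega
  -- Every outside vertex has at least two neighbours in `T`, which bounds |Tᶜ| by about 3(k - 2)/2
  -- and yields the degree condition. The parities of `k` and |Tᶜ| settle the small cases.
  obtain ⟨σ, hσ, hσT, hσa⟩ := G.exists_involutive_adj_compl T hqe fun v hv => by
    have h4 := hsplit v
    have h5 := hm2 v
    have h6 : (T.filter (G.Adj v)).card ≤ 3 := hTc ▸ Finset.card_filter_le _ _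
    have h7 := hcount' v hv
    have h8 := hdQ v hv
    obtain ⟨m, hm⟩ := hqe
    obtain ⟨i, hi⟩ := hje
    omega
  -- If `r₃` were adjacent to every outside vertex, its degree `k` would be |V| - 1.
  obtain ⟨w, hwT, hw⟩ : ∃ w ∉ T, ¬ G.Adj r₃ w := by
    by_contra! hall
    have h4 := hsplit r₃
    rw [hmT r₃ hr₃, hdeg₃, Finset.filter_true_of_mem fun v hv =>
      hall v (Finset.mem_compl.1 hv)] at h4
    omega
  have hσw := (hσa w hwT).1
  -- Since `σ w` has two neighbours in `T`, one of them differs from `r₃` and can serve as `r`.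
  obtain ⟨r, hr, r', hr', hrr', hrs, hr's, hwr, hTr⟩ : ∃ r ∈ T, ∃ r' ∈ T, r ≠ r' ∧ r ≠ r₃ ∧ r' ≠ r₃ ∧
      G.Adj (σ w) r ∧ (T : Set V) = {r, r', r₃} := by
    obtain ⟨z, hz, z', hz', hzz', hvz, hvz'⟩ := htw (σ w)
    simp only [T, Finset.mem_insert, Finset.mem_singleton] at hz hz'
    by_cases h1 : G.Adj (σ w) r₁
    · exact ⟨r₁, by simp [T], r₂, by simp [T], h12, h13, h23, h1, by simp [T]⟩
    · refine ⟨r₂, by simp [T], r₁, by simp [T], h12.symm, h23, h13, ?_, by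
        simp [T, Set.insert_comm r₁]⟩
      rcases hz with rfl | rfl | rfl
      · exact absurd hvz h1
      · exact hvz
      · rcases hz' with rfl | rfl | rfl
        · exact absurd hvz' h1
        · exact hvz'
        · exact absurd rfl hzz'
  refine hG (edgeColorable_of_involutive (r := r) (r' := r') (s := r₃) (w := w) (by omega)
    (fun v => (G.ndeg_eq_degree v).le.trans (hdeg v)) (hTT.trans hTr).le (hcl r hr r₃ hr₃ hrs)
    (hcl r' hr' r₃ hr₃ hr's) hrr' hw hσ ?_ ?_ ?_ hwr.symm)
  · rw [← hTr]
    exact fun v hv => hσT v (by exact_mod_cast hv)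
  · rw [← hTr]
    exact fun v hv => (hσa v (by exact_mod_cast hv)).2
  · rw [← hTr]
    exact_mod_cast hwT

/-! ### Tight graphs -/

/-- No fewer than `(t - 1) / 2` edges have to be removed from `G` to make it edge `k`-colourable,
where `t` is the number of vertices of degree `k`. -/
def IsTight (G : SimpleGraph V) (k : ℕ) : Prop :=
  ∀ F : Finset (Sym2 V), (F : Set (Sym2 V)) ⊆ G.edgeSet → (G.deleteEdges F).EdgeColorable k →
    (G.majors k).ncard ≤ 2 * F.card + 1

/-- The deletion spends one edge and lowers the number of majors by two, so both sides of the
tightness inequality drop equally. -/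
theorem IsTight.deleteEdges_singleton [Finite V] {G : SimpleGraph V} {k : ℕ} (h : G.IsTight k)
    {a b : V} (hab : G.Adj a b) (ha : a ∈ G.majors k) (hb : b ∈ G.majors k) :
    (G.deleteEdges {s(a, b)}).IsTight k := by
  classical
  intro F hF hcol
  have h1 := h (insert s(a, b) F) (by
    rw [Finset.coe_insert]
    exact edgeSet_insert_deleteEdges hab hF) (by
    rwa [Finset.coe_insert, Set.insert_eq, ← deleteEdges_deleteEdges])
  have h2 := ncard_majors_deleteEdges_singleton hab ha hb
  have h3 := Finset.card_insert_le s(a, b) F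
  omega

theorem IsTight.not_edgeColorable {G : SimpleGraph V} {k : ℕ} (h : G.IsTight k)
    {a b : V} (hab : G.Adj a b) (h3 : 3 < (G.majors k).ncard) :
    ¬ (G.deleteEdges {s(a, b)}).EdgeColorable k := by
  intro hcol
  have := h {s(a, b)} (by simpa using hab) (by simpa using hcol)
  simp at this
  omega

/-- The vertices of maximum degree of a tight graph are pairwise adjacent. -/
theorem IsTight.adj_of_mem_majors [Finite V] {k : ℕ} (hk : k ≠ 0) {G : SimpleGraph V}
    (ht : G.IsTight k) (hG : ¬ G.EdgeColorable k) (hdeg : ∀ v, G.ndeg v ≤ k)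
    (hodd : Odd (G.majors k).ncard) :
    ∀ x ∈ G.majors k, ∀ y ∈ G.majors k, x ≠ y → G.Adj x y := by
  induction h : (G.majors k).ncard using Nat.strong_induction_on generalizing G with
  | _ t ih =>
    have h3 := three_le_ncard_majors hk hG hdeg
    obtain ⟨H, hHG, hne, hval⟩ := exists_critical_subgraph hk G hG hdeg
    have hHdeg : ∀ v, H.ndeg v ≤ k := fun v => (ndeg_mono hHG v).trans (hdeg v)
    have hsub : ∀ v ∈ H.majors k, v ∈ G.majors k := fun v hv =>
      le_antisymm (hdeg v) ((mem_majors.1 hv).symm.le.trans (ndeg_mono hHG v))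
    obtain ⟨a, ha, b, hb, c, hc, hbc, hab, hac⟩ := exists_three_majors hHdeg hne hval
    by_cases ht3 : (G.majors k).ncard = 3
    · have hT : G.majors k = {a, b, c} := by
        refine (Set.eq_of_subset_of_ncard_le ?_ ?_ (Set.toFinite _)).symm
        · rintro v (rfl | rfl | rfl)
          · exact hsub _ ha
          · exact hsub _ hb
          · exact hsub _ hc
        · rw [ht3, Set.ncard_eq_three.2 ⟨a, b, c, hab.ne, hac.ne, hbc, rfl⟩]
      have hbc' : G.Adj b c := by
        obtain ⟨z, hz, z', hz', hzz', hbz, hbz'⟩ := exists_adj_two_majors hHdeg hval hab.symm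
        have h1 := hsub z hz
        have h2 := hsub z' hz'
        rw [hT] at h1 h2
        rcases h1 with rfl | rfl | rfl
        · rcases h2 with rfl | rfl | rfl
          · exact absurd rfl hzz'
          · exact absurd rfl hbz'.ne
          · exact hHG hbz'
        · exact absurd rfl hbz.ne
        · exact hHG hbz
      have hab' := hHG hab
      have hac' := hHG hac
      rw [hT]
      rintro x (rfl | rfl | rfl) y (rfl | rfl | rfl) hxy <;>
        first
        | exact absurd rfl hxy
        | assumption
        | (apply Adj.symm; assumption)
    · have hstep : ∀ c ∈ G.majors k, ∀ d ∈ G.majors k, G.Adj c d → ∀ x ∈ G.majors k,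
          ∀ y ∈ G.majors k, x ≠ c → x ≠ d → y ≠ c → y ≠ d → x ≠ y → G.Adj x y := by
        intro c hc d hd hcd x hx y hy hxc hxd hyc hyd hxy
        have h1 := ncard_majors_deleteEdges_singleton hcd hc hd
        have h2 := majors_deleteEdges_singleton hcd hc hd
        have h4 : Odd ((G.deleteEdges {s(c, d)}).majors k).ncard := by
          rw [← h1] at hodd
          simpa [Nat.odd_add] using hodd
        refine deleteEdges_le _ (ih _ (by omega) (ht.deleteEdges_singleton hcd hc hd)
          (ht.not_edgeColorable hcd (by omega))
          (fun v => (ndeg_mono (deleteEdges_le _) v).trans (hdeg v)) h4 rfl x ?_ y ?_ hxy)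
        · rw [h2]
          exact ⟨hx, by simp [hxc, hxd]⟩
        · rw [h2]
          exact ⟨hy, by simp [hyc, hyd]⟩
      have ha' := hsub a ha
      have hb' := hsub b hb
      have hab' := hHG hab
      have h5 : 5 ≤ (G.majors k).ncard := by
        obtain ⟨m, hm⟩ := hodd
        omega
      -- As `t ≥ 5`, there are two further majors `c`, `d`. Deleting `ab` shows that they are
      -- adjacent; deleting `cd` instead then joins `y` to `a` and `b`.
      have hout : ∀ y ∈ G.majors k, y ≠ a → y ≠ b → G.Adj a y ∧ G.Adj b y := by
        intro y hy hya hyb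
        have h6 : 1 < (G.majors k \ {a, b, y}).ncard := by
          have h7 := Set.ncard_le_ncard_sdiff_add_ncard (G.majors k) {a, b, y} (Set.toFinite _)
          rw [Set.ncard_eq_three.2 ⟨a, b, y, hab'.ne, hya.symm, hyb.symm, rfl⟩] at h7
          omega
        obtain ⟨c, hc, d, hd, hcd⟩ := (Set.one_lt_ncard (Set.toFinite _)).1 h6
        simp only [Set.mem_sdiff, Set.mem_insert_iff, Set.mem_singleton_iff, not_or] at hc hd
        obtain ⟨hc, hca, hcb, hcy⟩ := hc
        obtain ⟨hd, hda, hdb, hdy⟩ := hd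
        have hcd' := hstep a ha' b hb' hab' c hc d hd hca hcb hda hdb hcd
        have h8 := hstep c hc d hd hcd'
        exact ⟨h8 a ha' y hy (Ne.symm hca) (Ne.symm hda) (Ne.symm hcy) (Ne.symm hdy) hya.symm,
          h8 b hb' y hy (Ne.symm hcb) (Ne.symm hdb) (Ne.symm hcy) (Ne.symm hdy) hyb.symm⟩
      intro x hx y hy hxy
      by_cases hxa : x = a
      · subst hxa
        by_cases hyb : y = b
        · exact hyb ▸ hab'
        · exact (hout y hy hxy.symm hyb).1
      by_cases hxb : x = b
      · subst hxb
        by_cases hya : y = a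
        · exact hya ▸ hab'.symm
        · exact (hout y hy hya hxy.symm).2
      by_cases hya : y = a
      · exact hya ▸ (hout x hx hxa hxb).1.symm
      by_cases hyb : y = b
      · exact hyb ▸ (hout x hx hxa hxb).2.symm
      exact hstep a ha' b hb' hab' x hx y hy hxa hxb hya hyb hxy

/-- The structure of connected tight graphs with an odd number of vertices of maximum degree. -/
theorem IsTight.card_eq [Finite V] {k : ℕ} (hk : k ≠ 0) {G : SimpleGraph V}
    (ht : G.IsTight k) (hG : ¬ G.EdgeColorable k) (hdeg : ∀ v, G.ndeg v ≤ k)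
    (hodd : Odd (G.majors k).ncard) (hconn : G.Connected) :
    Nat.card V = k + 1 ∧ Even k ∧ ∀ v, k ≤ G.ndeg v + 1 := by
  induction h : (G.majors k).ncard using Nat.strong_induction_on generalizing G with
  | _ t ih =>
    have h3 := three_le_ncard_majors hk hG hdeg
    by_cases ht3 : (G.majors k).ncard = 3
    · have h1 := card_eq_of_ncard_majors_eq_three hk hG hdeg hconn ht3
      exact ⟨h1.1, h1.2, (structure_of_ncard_majors_eq_three hk hG hdeg hconn ht3).2.1⟩
    · have hcl := ht.adj_of_mem_majors hk hG hdeg hodd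
      obtain ⟨T, hT, hT3⟩ := Set.exists_subset_card_eq h3
      obtain ⟨a, b, c, hab, hac, hbc, rfl⟩ := Set.ncard_eq_three.1 hT3
      have ha : a ∈ G.majors k := hT (by simp)
      have hb : b ∈ G.majors k := hT (by simp)
      have hc : c ∈ G.majors k := hT (by simp)
      have hab' := hcl a ha b hb hab
      have hac' := hcl a ha c hc hac
      have hbc' := hcl b hb c hc hbc
      have h1 := ncard_majors_deleteEdges_singleton hab' ha hb
      have h4 : Odd ((G.deleteEdges {s(a, b)}).majors k).ncard := by
        rw [← h1] at hodd
        simpa [Nat.odd_add] using hodd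
      have hac'' : (G.deleteEdges {s(a, b)}).Adj a c := by
        simp [deleteEdges_adj, hac', hbc.symm, hab]
      have hbc'' : (G.deleteEdges {s(a, b)}).Adj b c := by
        simp [deleteEdges_adj, hbc', hac.symm, hab.symm]
      -- The path `a`, `c`, `b` through a third major shows that `ab` is not a bridge.
      have hconn' : (G.deleteEdges {s(a, b)}).Connected := by
        refine hconn.connected_delete_edge_of_not_isBridge ?_
        rw [isBridge_iff]
        exact fun h => h (hac''.reachable.trans hbc''.symm.reachable)
      obtain ⟨h5, h6, h7⟩ := ih _ (by omega) (ht.deleteEdges_singleton hab' ha hb)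
        (ht.not_edgeColorable hab' (by omega))
        (fun v => (ndeg_mono (deleteEdges_le _) v).trans (hdeg v)) h4 hconn' rfl
      exact ⟨h5, h6, fun v => (h7 v).trans
        (Nat.add_le_add_right (ndeg_mono (deleteEdges_le _) v) 1)⟩

/-! ### Complements of matchings and edge counting -/

theorem ndeg_iso {W : Type*} {G : SimpleGraph V} {H : SimpleGraph W} (f : G ≃g H) (v : V) :
    H.ndeg (f v) = G.ndeg v := by
  rw [ndeg, ndeg, ← Nat.card_coe_set_eq, ← Nat.card_coe_set_eq]
  exact (Nat.card_congr (f.mapNeighborSet v)).symm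

theorem ndeg_add_ndeg_compl_add_one [Finite V] (G : SimpleGraph V) (v : V) :
    G.ndeg v + Gᶜ.ndeg v + 1 = Nat.card V := by
  classical
  have := Fintype.ofFinite V
  rw [ndeg_eq_degree, ndeg_eq_degree, degree_compl, Nat.card_eq_fintype_card]
  have := G.degree_lt_card_verts v
  omega

theorem sum_ndeg_eq_two_mul_ncard [Fintype V] (G : SimpleGraph V) :
    ∑ v, G.ndeg v = 2 * G.edgeSet.ncard := by
  classical
  simp_rw [ndeg_eq_degree]
  rw [G.sum_degrees_eq_twice_card_edges, Set.ncard_eq_toFinset_card', edgeFinset]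

theorem two_mul_ncard_edgeSet_add_compl [Finite V] (G : SimpleGraph V) {m : ℕ}
    (hV : Nat.card V = m + 1) :
    2 * G.edgeSet.ncard + 2 * Gᶜ.edgeSet.ncard = (m + 1) * m := by
  have := Fintype.ofFinite V
  rw [← sum_ndeg_eq_two_mul_ncard, ← sum_ndeg_eq_two_mul_ncard, ← Finset.sum_add_distrib]
  have : ∀ v ∈ Finset.univ, G.ndeg v + Gᶜ.ndeg v = m := fun v _ => by
    have := G.ndeg_add_ndeg_compl_add_one v
    omega
  rw [Finset.sum_congr rfl this, Finset.sum_const, Finset.card_univ, ← Nat.card_eq_fintype_card, hV,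
    smul_eq_mul]

/-- If the complement of `G` is a matching, its edges cover the vertices that are not adjacent to all
others. -/
theorem ncard_majors_add_two_mul_ncard_compl [Finite V] (G : SimpleGraph V) {m : ℕ}
    (hV : Nat.card V = m + 1) (hdeg : ∀ v, m ≤ G.ndeg v + 1) :
    (G.majors m).ncard + 2 * Gᶜ.edgeSet.ncard = m + 1 := by
  classical
  have := Fintype.ofFinite V
  -- Each vertex is either adjacent to all others or has exactly one non-neighbour.
  have h1 : ∀ v, (if v ∈ G.majors m then 1 else 0) + Gᶜ.ndeg v = 1 := by
    intro v
    have := G.ndeg_add_ndeg_compl_add_one v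
    have := hdeg v
    simp only [mem_majors]
    split_ifs <;> omega
  have h2 : (G.majors m).ncard = ∑ v : V, (if v ∈ G.majors m then 1 else 0) := by
    rw [Set.ncard_eq_toFinset_card', ← Finset.card_filter]
    congr 1
    ext v
    simp
  rw [h2, ← sum_ndeg_eq_two_mul_ncard, ← Finset.sum_add_distrib,
    Finset.sum_congr rfl fun v _ => h1 v, ← hV, Nat.card_eq_fintype_card]
  simp

/-- A colour class on `2 n + 1` vertices has at most `n` edges. -/
theorem EdgeColorable.ncard_edgeSet_le [Finite V] {G : SimpleGraph V} {k n : ℕ}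
    (h : G.EdgeColorable k) (hV : Nat.card V = 2 * n + 1) : G.edgeSet.ncard ≤ n * k := by
  classical
  have := Fintype.ofFinite V
  obtain ⟨φ, hφ⟩ := h
  have hclass : ∀ c, (G.edgeFinset.filter fun e => φ e = c).card ≤ n := by
    intro c
    -- A colour class has maximum degree at most one, so twice its size is at most `2 * n + 1`.
    let K : SimpleGraph V :=
      { Adj := fun u v => G.Adj u v ∧ φ s(u, v) = c
        symm := ⟨fun u v h => by rw [Sym2.eq_swap]; exact ⟨h.1.symm, h.2⟩⟩
        loopless := ⟨fun u h => G.loopless.irrefl u h.1⟩ }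
    have hK : (G.edgeFinset.filter fun e => φ e = c) = K.edgeFinset := by
      ext e
      induction e using Sym2.ind with
      | _ u v => simp [K]
    have h1 : ∑ v, K.ndeg v ≤ ∑ _v : V, 1 := by
      refine Finset.sum_le_sum fun v _ => Set.ncard_le_one (Set.toFinite _) |>.2 ?_
      intro a ha b hb
      exact hφ v a b ha.1 hb.1 (ha.2.trans hb.2.symm)
    rw [sum_ndeg_eq_two_mul_ncard, Finset.sum_const, Finset.card_univ, ← Nat.card_eq_fintype_card,
      hV, Set.ncard_eq_toFinset_card', smul_eq_mul, mul_one] at h1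
    rw [hK, edgeFinset]
    omega
  rw [Set.ncard_eq_toFinset_card', ← edgeFinset]
  have := Finset.card_le_mul_card_image_of_maps_to (s := G.edgeFinset) (t := Finset.univ)
    (f := φ) (fun _ _ => Finset.mem_univ _) n fun c _ => hclass c
  simpa using this

/-- The complement has maximum degree at most one; carried over to `Fin (m + 1)` and restricted to
its support, it is the matching to be removed. -/
theorem isCompleteMinusIndepEdges_of_ndeg [Finite V] {G : SimpleGraph V} {m : ℕ}
    (hV : Nat.card V = m + 1) (hdeg : ∀ v, m ≤ G.ndeg v + 1) :
    G.IsCompleteMinusIndepEdges (m + 1) Gᶜ.edgeSet.ncard := by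
  classical
  have := Fintype.ofFinite V
  let e : V ≃ Fin (m + 1) := Fintype.equivFinOfCardEq (by rw [← Nat.card_eq_fintype_card, hV])
  let G₂ : SimpleGraph (Fin (m + 1)) := G.map e.toEmbedding
  let f : G ≃g G₂ := Iso.map e G
  let fc : Gᶜ ≃g G₂ᶜ := ⟨e, fun {a b} => by
    have := f.map_adj_iff (v := a) (w := b)
    simp only [compl_adj, e.injective.ne_iff]
    exact and_congr_right fun _ => not_congr this⟩
  let M : (completeGraph (Fin (m + 1))).Subgraph :=
    { verts := G₂ᶜ.support
      Adj := G₂ᶜ.Adj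
      adj_sub := fun h => h.ne
      edge_vert := fun h => ⟨_, h⟩
      symm := ⟨fun _ _ h => h.symm⟩ }
  have hM : M.edgeSet = G₂ᶜ.edgeSet := by
    ext x
    induction x using Sym2.ind with
    | _ u v => rfl
  refine ⟨M, ?_, ?_, ⟨?_⟩⟩
  · rintro v ⟨w, hw⟩
    refine ⟨w, hw, fun u hu => ?_⟩
    obtain ⟨v, rfl⟩ := f.surjective v
    have h1 := G₂.ndeg_add_ndeg_compl_add_one (f v)
    rw [ndeg_iso f, Nat.card_eq_fintype_card, Fintype.card_fin] at h1
    have h2 := hdeg v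
    exact Set.ncard_le_one (s := G₂ᶜ.neighborSet (f v)) (Set.toFinite _) |>.1
      (by change G₂ᶜ.ndeg (f v) ≤ 1; omega) u hu w hw
  · rw [hM, ← Nat.card_coe_set_eq, ← Nat.card_coe_set_eq]
    exact (Nat.card_congr fc.mapEdgeSet).symm
  · have : (completeGraph (Fin (m + 1))).deleteEdges M.edgeSet = G₂ := by
      rw [hM]
      ext u v
      simp only [deleteEdges_adj, completeGraph, top_adj, mem_edgeSet, compl_adj]
      have : G₂.Adj u v → u ≠ v := fun h => h.ne
      tauto
    exact this ▸ f

theorem IsCompleteMinusIndepEdges.ndeg_and_ncard [Finite V] {G : SimpleGraph V} {m s : ℕ}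
    (h : G.IsCompleteMinusIndepEdges (m + 1) s) :
    Nat.card V = m + 1 ∧ (∀ v, m ≤ G.ndeg v + 1) ∧ Gᶜ.edgeSet.ncard = s := by
  classical
  obtain ⟨M, hM, hs, ⟨f⟩⟩ := h
  let G₂ := (completeGraph (Fin (m + 1))).deleteEdges M.edgeSet
  have hadj : ∀ u v, G₂ᶜ.Adj u v ↔ M.Adj u v := by
    intro u v
    have : M.Adj u v → u ≠ v := fun h => h.ne
    simp only [G₂, compl_adj, deleteEdges_adj, completeGraph, top_adj, Subgraph.mem_edgeSet]
    tauto
  have hV : Nat.card V = m + 1 := by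
    rw [Nat.card_congr f.toEquiv, Nat.card_eq_fintype_card, Fintype.card_fin]
  let fc : Gᶜ ≃g G₂ᶜ := ⟨f.toEquiv, fun {a b} => by
    have := f.map_adj_iff (v := a) (w := b)
    simp only [compl_adj, f.toEquiv.injective.ne_iff]
    exact and_congr_right fun _ => not_congr this⟩
  refine ⟨hV, fun v => ?_, ?_⟩
  · have h1 := G₂.ndeg_add_ndeg_compl_add_one (f v)
    rw [Nat.card_eq_fintype_card, Fintype.card_fin, ndeg_iso f] at h1
    have h2 : G₂ᶜ.ndeg (f v) ≤ 1 := by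
      refine Set.ncard_le_one (Set.toFinite _) |>.2 fun a ha b hb => ?_
      rw [mem_neighborSet, hadj] at ha hb
      exact (hM (M.edge_vert ha)).unique ha hb
    omega
  · rw [← hs, ← Nat.card_coe_set_eq, Nat.card_congr fc.mapEdgeSet, Nat.card_coe_set_eq]
    congr 1
    ext e
    induction e using Sym2.ind with
    | _ u v => exact hadj u v

/-! ### The stability index and the main theorem -/

/-- The chromatic edge stability index of a graph with chromatic index `k + 1` is at most the number
of edges in any set whose removal leaves an edge `k`-colourable graph. -/
theorem edgeStabilityIndex_le_card [Finite V] {G : SimpleGraph V} {k : ℕ} (hk : k ≠ 0)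
    (hG : G.chromaticIndex = (k : ℕ∞) + 1) {F : Finset (Sym2 V)}
    (hF : (F : Set (Sym2 V)) ⊆ G.edgeSet) (hcol : (G.deleteEdges F).EdgeColorable k) :
    G.edgeStabilityIndex ≤ F.card := by
  classical
  -- The index asks for chromatic index exactly `k`, which removing `F` may undershoot. Each single
  -- deletion lowers it by at most one, so some subset of `F` hits `k`.
  obtain ⟨F', hF', hF'k⟩ : ∃ F' ⊆ F, (G.deleteEdges F').chromaticIndex = k := by
    rw [edgeColorable_iff_chromaticIndex_le hk] at hcol
    clear hF
    induction F using Finset.induction with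
    | empty =>
      rw [Finset.coe_empty, deleteEdges_empty, hG] at hcol
      exact absurd (by exact_mod_cast hcol : k + 1 ≤ k) (by omega)
    | insert e F he ih =>
      by_cases h : (G.deleteEdges F).chromaticIndex ≤ k
      · obtain ⟨F', hF', h'⟩ := ih h
        exact ⟨F', hF'.trans (Finset.subset_insert _ _), h'⟩
      · refine ⟨insert e F, Finset.Subset.rfl, le_antisymm hcol ?_⟩
        have h1 := (G.deleteEdges F).chromaticIndex_le_deleteEdges_singleton_add_one e
        rw [deleteEdges_deleteEdges, Set.union_comm, ← Set.insert_eq, ← Finset.coe_insert] at h1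
        exact (ENat.add_le_add_iff_right ENat.one_ne_top).1
          ((Order.add_one_le_of_lt (not_le.1 h)).trans h1)
  have h : G.edgeStabilityIndex ≤ F'.card :=
    Nat.sInf_le ⟨F', fun x hx => hF (hF' hx), rfl, by rw [hF'k, hG]⟩
  exact h.trans (Finset.card_le_card hF')

theorem exists_deleteEdges_card_eq_edgeStabilityIndex [Finite V] {G : SimpleGraph V} {k : ℕ}
    (hk : k ≠ 0) (hG : G.chromaticIndex = (k : ℕ∞) + 1) :
    ∃ F : Finset (Sym2 V), (F : Set (Sym2 V)) ⊆ G.edgeSet ∧ F.card = G.edgeStabilityIndex ∧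
      (G.deleteEdges F).EdgeColorable k := by
  have hne : G.edgeSet.Nonempty := by
    by_contra h
    rw [Set.not_nonempty_iff_eq_empty, edgeSet_eq_empty] at h
    have := (edgeColorable_iff_chromaticIndex_le hk).1 (h ▸ edgeColorable_bot hk)
    rw [hG] at this
    exact absurd (by exact_mod_cast this : k + 1 ≤ k) (by omega)
  obtain ⟨F, hF, hFc, h⟩ := exists_card_eq_edgeStabilityIndex G hne
  refine ⟨F, hF, hFc, (edgeColorable_iff_chromaticIndex_le hk).2 ?_⟩
  rw [hG] at h
  exact (ENat.add_le_add_iff_right ENat.one_ne_top).1 h.le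

end SimpleGraph

theorem theorem4 {V : Type*} [Fintype V] (G : SimpleGraph V) [DecidableRel G.Adj]
    (hG : G.IsClassTwo) :
    (G.edgeStabilityIndex : ℚ) ≤ ((G.numDegree G.maxDegree : ℚ) - 1) / 2 ∧
    (G.Connected → Odd (G.numDegree G.maxDegree) →
      ((G.edgeStabilityIndex : ℚ) = ((G.numDegree G.maxDegree : ℚ) - 1) / 2 ↔
        ∃ n s : ℕ, s + 1 ≤ n ∧ G.IsCompleteMinusIndepEdges (2 * n + 1) s)) := by
  classical
  have hχ : G.chromaticIndex = (G.maxDegree : ℕ∞) + 1 := hG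
  obtain ⟨k, hk⟩ : ∃ k, G.maxDegree = k := ⟨_, rfl⟩
  rw [hk] at hχ
  have hdeg : ∀ v, G.ndeg v ≤ k := fun v => by
    rw [G.ndeg_eq_degree, ← hk]
    exact G.degree_le_maxDegree v
  have hk0 : k ≠ 0 := by
    rintro rfl
    have hemp : IsEmpty G.edgeSet := by
      refine ⟨fun ⟨e, he⟩ => ?_⟩
      induction e using Sym2.ind with
      | _ u v =>
        have h1 := hdeg u
        rw [G.ndeg_eq_degree] at h1
        have h2 := (G.degree_pos_iff_exists_adj u).2 ⟨v, he⟩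
        omega
    have h1 := (SimpleGraph.Colorable.of_isEmpty (G := G.lineGraph) 0).chromaticNumber_le
    rw [SimpleGraph.chromaticIndex] at hχ
    rw [hχ] at h1
    simp at h1
  have hcol : ¬ G.EdgeColorable k := by
    rw [SimpleGraph.edgeColorable_iff_chromaticIndex_le hk0, hχ]
    intro h
    exact absurd (by exact_mod_cast h : k + 1 ≤ k) (by omega)
  have ht : G.numDegree k = (G.majors k).ncard := by
    rw [SimpleGraph.numDegree, ← Set.ncard_coe_finset]
    congr 1
    ext v
    simp [G.ndeg_eq_degree]
  rw [hk, ht]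
  have hbound : 2 * G.edgeStabilityIndex + 1 ≤ (G.majors k).ncard := by
    obtain ⟨F, hF, hFc, hFcol⟩ := SimpleGraph.exists_deleteEdges_edgeColorable hk0 G hcol hdeg
    have := SimpleGraph.edgeStabilityIndex_le_card hk0 hχ hF hFcol
    omega
  have hboundQ : 2 * (G.edgeStabilityIndex : ℚ) + 1 ≤ (G.majors k).ncard := by
    exact_mod_cast hbound
  refine ⟨by linarith, fun hconn hodd => ⟨fun heq => ?_, ?_⟩⟩
  · have heq' : (G.majors k).ncard = 2 * G.edgeStabilityIndex + 1 := by
      have : ((G.majors k).ncard : ℚ) = 2 * G.edgeStabilityIndex + 1 := by linarith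
      exact_mod_cast this
    have htight : G.IsTight k := fun F hF hFcol => by
      have := SimpleGraph.edgeStabilityIndex_le_card hk0 hχ hF hFcol
      omega
    obtain ⟨hV, ⟨n, hn⟩, hlow⟩ := htight.card_eq hk0 hcol hdeg hodd hconn
    have h1 := G.ncard_majors_add_two_mul_ncard_compl hV hlow
    have h2 := SimpleGraph.three_le_ncard_majors hk0 hcol hdeg
    -- The strict bound on `s` comes from `t ≥ 3` and `t + 2s = 2n + 1`.
    refine ⟨n, Gᶜ.edgeSet.ncard, by omega, ?_⟩
    have h3 := SimpleGraph.isCompleteMinusIndepEdges_of_ndeg hV hlow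
    rwa [hn, ← two_mul] at h3
  · rintro ⟨n, s, hsn, hK⟩
    obtain ⟨hV, hlow, hs⟩ := hK.ndeg_and_ncard
    have h1 := G.ncard_majors_add_two_mul_ncard_compl hV hlow
    have h2 := G.two_mul_ncard_edgeSet_add_compl hV
    -- Since `s < n`, some vertex meets no removed edge, so the maximum degree is `2 * n`.
    obtain ⟨v, hv⟩ := Set.nonempty_of_ncard_ne_zero (s := G.majors (2 * n)) (by omega)
    have hkn : k = 2 * n := by
      refine le_antisymm ?_ ((SimpleGraph.mem_majors.1 hv).symm.le.trans (hdeg v))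
      rw [← hk]
      refine G.maxDegree_le_of_forall_degree_le _ fun u => ?_
      have := G.degree_lt_card_verts u
      rw [← Nat.card_eq_fintype_card] at this
      omega
    subst hkn
    obtain ⟨F, hF, hFc, hFcol⟩ :=
      SimpleGraph.exists_deleteEdges_card_eq_edgeStabilityIndex hk0 hχ
    have h3 := hFcol.ncard_edgeSet_le hV
    have h4 : (G.deleteEdges F).edgeSet.ncard + F.card = G.edgeSet.ncard := by
      rw [SimpleGraph.edgeSet_deleteEdges, ← Set.ncard_coe_finset F]
      exact Set.ncard_sdiff_add_ncard_of_subset hF (Set.toFinite _)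
    -- Here `|E| = n(2n + 1) - s` and `|E| - |F| ≤ 2n²` give `|F| ≥ n - s`, while `t = 2n + 1 - 2s`.
    have h5 : (G.majors (2 * n)).ncard ≤ 2 * G.edgeStabilityIndex + 1 := by
      have h6 : (2 * n + 1) * (2 * n) = 2 * (n * (2 * n)) + 2 * n := by ring
      omega
    have h6 : ((G.majors (2 * n)).ncard : ℚ) ≤ 2 * G.edgeStabilityIndex + 1 := by
      exact_mod_cast h5
    linarith
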